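/- Let $Z,X_1,\dots,X_m$ be random variables with values in standard Borel spaces and joint distribution $Q_{ZX^m}$. A key generation scheme with finite alphabets $\mathcal K,\mathcal W_1,\dots,\mathcal W_m$ consists of a (possibly stochastic) map that produces $(K,W_1,\dots,W_m)\in\mathcal K\times\mathcal W_1\times\dots\times\mathcal W_m$ from $Z$, and for each $l$ a (possibly stochastic) map that produces $K_l\in\mathcal K$ from $(X_l,W_l)$. For a joint law $P_{AB}$ let $\imath_{A;B}=\log\frac{dP_{AB}}{d(P_A\times P_B)}$, and let $\imath_{A;B|C}(a;b|c)=\log\frac{dP_{AB|C=c}}{d(P_{A|C=c}\times P_{B|C=c})}(a,b)$, with the value $+\infty$ on the singular part. Logarithms are natural, and $\log 0=-\infty$. Fix an arbitrary $Q_{U|Z}$ and, for $1\le l\le m$, an arbitrary $Q_{US_l|Z}$ with $U$-marginal $Q_{U|Z}$, where $U$ and $S_l$ take values in standard Borel spaces and $(U,S_l)-Z-X^m$ is a Markov chain. Let $I_0,\dots,I_m,J_1,\dots,J_m$ be positive integers, and put $I:=\prod_{i=0}^m I_i$, $$T:=\inf_{\gamma\in\mathbb R}\Big\{\mathbb P[\imath_{U;Z}(U;Z)>\gamma]+\frac{\exp(\gamma/2)}{2\sqrt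 I}\Big\},\qquad T_l:=\inf_{\gamma\in\mathbb R}\Big\{\mathbb P[\imath_{S_l;Z|U}(S_l;Z|U)>\gamma]+\frac{\exp(\gamma/2)}{2\sqrt{J_l}}\Big\},$$ $$\epsilon:=\max_{1\le l\le m}\inf_{\gamma\in\mathbb R}\Big\{\mathbb P\Big[\imath_{US_l;X_l}(US_l;X_l)\le\log\Big(I_0\prod_{i=l+1}^m I_i-1\Big)+\gamma\Big]+\exp(-\gamma)\Big\}.$$ Then there is a single key generation scheme with $|\mathcal K|=I_0$ and $|\mathcal W_l|=J_l\prod_{i=1}^l I_i$ for all $l$ such that, for every $1\le l\le m$, $$\mathbb P[K\ne K_l]\le 2m(\epsilon+T+T_l),$$ $$\log|\mathcal K|-H(K|W_l)\le\inf_{0<\delta<(IJ_l)^{3/2}\exp(-1)}\Big\{4m(2T+T_l+2\delta)\log\frac{(IJ_l)^{3/2}}{\delta}\Big\}.$$ -/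

import Mathlib

open MeasureTheory ProbabilityTheory
open scoped ENNReal

namespace OneCommunicator

noncomputable section

/-- Relative information `log (dP/dQ)` of `P` with respect to `Q`, as an extended real function.
Both measures are differentiated with respect to the dominating measure `P + Q`, so the value is
`+∞` on the part of `P` that is singular to `Q`, and no absolute continuity is needed. -/
def relInfo {α : Type*} [MeasurableSpace α] (P Q : Measure α) (x : α) : EReal :=
  ENNReal.log (P.rnDeriv (P + Q) x / Q.rnDeriv (P + Q) x)

/-- Information density `ı_{A;B}(a;b) = log dP_{AB}/d(P_A × P_B) (a,b)` of a joint law. -/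
def infoDensity {α β : Type*} [MeasurableSpace α] [MeasurableSpace β]
    (P : Measure (α × β)) : α × β → EReal :=
  relInfo P (P.fst.prod P.snd)

/-- Conditional information density
`ı_{B;C|A}(b;c|a) = log dP_{BC|A=a}/d(P_{B|A=a} × P_{C|A=a}) (b,c)`
of a joint law of `(A, B, C)`, written as the relative information of `P_{ABC}` with respect to
`P_A P_{B|A} P_{C|A}`. -/
def condInfoDensity {α β γ : Type*} [MeasurableSpace α]
    [MeasurableSpace β] [StandardBorelSpace β] [Nonempty β]
    [MeasurableSpace γ] [StandardBorelSpace γ] [Nonempty γ]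
    (P : Measure (α × β × γ)) [IsFiniteMeasure P] : α × β × γ → EReal :=
  relInfo P (P.fst ⊗ₘ
    ((P.map (fun p => (p.1, p.2.1))).condKernel ×ₖ (P.map (fun p => (p.1, p.2.2))).condKernel))

/-- `inf_γ { P[ı > γ] + exp(γ/2) / (2 √M) }`. -/
def coveringTerm {Ω : Type*} [MeasurableSpace Ω] (P : Measure Ω) (i : Ω → EReal) (M : ℕ) : ℝ :=
  ⨅ γ : ℝ, P.real {ω | (γ : EReal) < i ω} + Real.exp (γ / 2) / (2 * Real.sqrt M)

/-- `inf_γ { P[ı ≤ log (M - 1) + γ] + exp(-γ) }` for `M ≥ 1` messages, where `log 0 = -∞`. -/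
def decodingTerm {Ω : Type*} [MeasurableSpace Ω] (P : Measure Ω) (i : Ω → EReal) (M : ℕ) : ℝ :=
  ⨅ γ : ℝ, P.real {ω | i ω ≤ ENNReal.log ((M - 1 : ℕ) : ℝ≥0∞) + (γ : EReal)} + Real.exp (-γ)

/-- Conditional Shannon entropy `H(K|W) = ∑_w P[W = w] H(K | W = w)` (in nats) of the joint law
of a pair `(K, W)` with finitely many values. -/
def condEntropy {κ ω : Type*} [Fintype κ] [Fintype ω] [MeasurableSpace κ] [MeasurableSpace ω]
    (P : Measure (κ × ω)) : ℝ :=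
  ∑ w : ω, P.snd.real {w} * ∑ k : κ, Real.negMulLog (P.real {(k, w)} / P.snd.real {w})

section Source

variable {m : ℕ} {𝒵 : Type*} [MeasurableSpace 𝒵] {𝒳 : Fin m → Type*}
  [∀ l, MeasurableSpace (𝒳 l)]

/-- The law of `((Z, X^m), A)` when `(Z, X^m)` has law `Q` and `A` is generated from `Z` by the
kernel `κ`, so that `A - Z - X^m` is a Markov chain. -/
def jointLaw {α : Type*} [MeasurableSpace α] (Q : Measure (𝒵 × (∀ l, 𝒳 l))) (κ : Kernel 𝒵 α) :
    Measure ((𝒵 × (∀ l, 𝒳 l)) × α) :=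
  Q ⊗ₘ κ.comap Prod.fst measurable_fst

/-- The law of `(U, Z)`. -/
def lawUZ {𝒰 : Type*} [MeasurableSpace 𝒰] (Q : Measure (𝒵 × (∀ l, 𝒳 l))) (κ : Kernel 𝒵 𝒰) :
    Measure (𝒰 × 𝒵) :=
  (jointLaw Q κ).map (fun p => (p.2, p.1.1))

/-- The law of `(U, S, Z)`. -/
def lawUSZ {𝒰 𝒮 : Type*} [MeasurableSpace 𝒰] [MeasurableSpace 𝒮]
    (Q : Measure (𝒵 × (∀ l, 𝒳 l))) (κ : Kernel 𝒵 (𝒰 × 𝒮)) : Measure (𝒰 × 𝒮 × 𝒵) :=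
  (jointLaw Q κ).map (fun p => (p.2.1, p.2.2, p.1.1))

/-- The law of `((U, S), X_l)`. -/
def lawUSX {𝒰 𝒮 : Type*} [MeasurableSpace 𝒰] [MeasurableSpace 𝒮]
    (Q : Measure (𝒵 × (∀ l, 𝒳 l))) (κ : Kernel 𝒵 (𝒰 × 𝒮)) (l : Fin m) :
    Measure ((𝒰 × 𝒮) × 𝒳 l) :=
  (jointLaw Q κ).map (fun p => (p.2, p.1.2 l))

instance isFiniteMeasure_lawUSZ {𝒰 𝒮 : Type*} [MeasurableSpace 𝒰] [MeasurableSpace 𝒮]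
    (Q : Measure (𝒵 × (∀ l, 𝒳 l))) [IsFiniteMeasure Q]
    (κ : Kernel 𝒵 (𝒰 × 𝒮)) [IsFiniteKernel κ] : IsFiniteMeasure (lawUSZ Q κ) := by
  unfold lawUSZ jointLaw
  infer_instance

end Source

/-- A key generation scheme with one communicator. The communicator observes `Z` and produces,
possibly stochastically, the key `K` and the messages `W_1, …, W_m`; terminal `l` produces,
possibly stochastically, its key `K_l` from `(X_l, W_l)`. -/
structure KeyScheme {m : ℕ} (𝒵 : Type*) [MeasurableSpace 𝒵]
    (𝒳 : Fin m → Type*) [∀ l, MeasurableSpace (𝒳 l)]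
    (𝒦 : Type*) [MeasurableSpace 𝒦] (𝒲 : Fin m → Type*) [∀ l, MeasurableSpace (𝒲 l)] where
  /-- the communicator's kernel from `Z` to `(K, W_1, …, W_m)` -/
  enc : Kernel 𝒵 (𝒦 × (∀ l, 𝒲 l))
  /-- the kernel of terminal `l` from `(X_l, W_l)` to `K_l` -/
  dec : ∀ l, Kernel (𝒳 l × 𝒲 l) 𝒦
  isMarkov_enc : IsMarkovKernel enc
  isMarkov_dec : ∀ l, IsMarkovKernel (dec l)

namespace KeyScheme

variable {m : ℕ} {𝒵 : Type*} [MeasurableSpace 𝒵] {𝒳 : Fin m → Type*}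
  [∀ l, MeasurableSpace (𝒳 l)] {𝒦 : Type*} [MeasurableSpace 𝒦] {𝒲 : Fin m → Type*}
  [∀ l, MeasurableSpace (𝒲 l)]

/-- The law of `((Z, X^m), (K, W^m), K_l)`. -/
def lawWithKey (C : KeyScheme 𝒵 𝒳 𝒦 𝒲) (Q : Measure (𝒵 × (∀ l, 𝒳 l))) (l : Fin m) :
    Measure (((𝒵 × (∀ l, 𝒳 l)) × (𝒦 × (∀ l, 𝒲 l))) × 𝒦) :=
  jointLaw Q C.enc ⊗ₘ (C.dec l).comap (fun p => (p.1.2 l, p.2.2 l)) (by fun_prop)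

/-- The disagreement probability `P[K ≠ K_l]`. -/
def errorProb (C : KeyScheme 𝒵 𝒳 𝒦 𝒲) (Q : Measure (𝒵 × (∀ l, 𝒳 l))) (l : Fin m) : ℝ :=
  (C.lawWithKey Q l).real {p | p.1.2.1 ≠ p.2}

/-- The law of `(K, W_l)`. -/
def lawKW (C : KeyScheme 𝒵 𝒳 𝒦 𝒲) (Q : Measure (𝒵 × (∀ l, 𝒳 l))) (l : Fin m) :
    Measure (𝒦 × 𝒲 l) :=
  (jointLaw Q C.enc).map (fun p => (p.2.1, p.2.2 l))

/-- The secrecy gap `log |𝒦| - H(K|W_l)`. -/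
def secrecyGap [Fintype 𝒦] [∀ l, Fintype (𝒲 l)]
    (C : KeyScheme 𝒵 𝒳 𝒦 𝒲) (Q : Measure (𝒵 × (∀ l, 𝒳 l))) (l : Fin m) : ℝ :=
  Real.log (Fintype.card 𝒦) - condEntropy (C.lawKW Q l)

end KeyScheme

section Bounds

variable {m : ℕ} {𝒵 : Type*} [MeasurableSpace 𝒵] {𝒳 : Fin m → Type*}
  [∀ l, MeasurableSpace (𝒳 l)] {𝒰 : Type*} [MeasurableSpace 𝒰]
  {𝒮 : Fin m → Type*} [∀ l, MeasurableSpace (𝒮 l)]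

/-- `T = inf_γ { P[ı_{U;Z}(U;Z) > γ] + exp(γ/2) / (2 √I) }` with `I = ∏_{i=0}^m I_i`. -/
def quantT (Q : Measure (𝒵 × (∀ l, 𝒳 l))) (QU : Kernel 𝒵 𝒰) (I : Fin (m + 1) → ℕ) : ℝ :=
  coveringTerm (lawUZ Q QU) (infoDensity (lawUZ Q QU)) (∏ i, I i)

/-- `T_l = inf_γ { P[ı_{S_l;Z|U}(S_l;Z|U) > γ] + exp(γ/2) / (2 √J_l) }`. -/
def quantTl [StandardBorelSpace 𝒵] [Nonempty 𝒵]
    [∀ l, StandardBorelSpace (𝒮 l)] [∀ l, Nonempty (𝒮 l)]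
    (Q : Measure (𝒵 × (∀ l, 𝒳 l))) [IsFiniteMeasure Q]
    (QUS : ∀ l, Kernel 𝒵 (𝒰 × 𝒮 l)) [∀ l, IsFiniteKernel (QUS l)] (J : Fin m → ℕ)
    (l : Fin m) : ℝ :=
  coveringTerm (lawUSZ Q (QUS l)) (condInfoDensity (lawUSZ Q (QUS l))) (J l)

/-- `ε = max_l inf_γ { P[ı_{US_l;X_l}(US_l;X_l) ≤ log (M_l - 1) + γ] + exp(-γ) }`, where
`M_l = I_0 ∏_{i=l+1}^m I_i` is the number of values of the indices that `W_l` does not reveal.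
The index `l : Fin m` stands for terminal `l + 1`, so `I_{l+1}` is `I l.succ`. -/
def quantEps (Q : Measure (𝒵 × (∀ l, 𝒳 l))) (QUS : ∀ l, Kernel 𝒵 (𝒰 × 𝒮 l))
    (I : Fin (m + 1) → ℕ) : ℝ :=
  ⨆ l : Fin m, decodingTerm (lawUSX Q (QUS l) l) (infoDensity (lawUSX Q (QUS l) l))
    (I 0 * ∏ i ∈ Finset.Ioi l, I i.succ)

end Bounds

end

end OneCommunicator

/-! The scheme is a random superposition code. The centres `u_i`, indexed by all of `∏ i, Fin (I
i)`, are drawn independently from `P_U`. Given `u_i`, each terminal `l` gets `J l` satellites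
`s_{l,i,j}` drawn from `P_{S_l|U}`. The communicator is a likelihood encoder: it picks `i` with
weight proportional to the density of `(u_i, z)` against `P_U × P_Z`, and then each `j_l` with
weight proportional to the density of `(u_i, s_{l,i,j}, z)` against `P_U P_{S|U} P_{Z|U}`. The key
is coordinate `0` of `i`; `W_l` reveals the coordinates `1, …, l` and `j_l`. Terminal `l` decodes by
maximum likelihood among the codewords compatible with `W_l`.

The analysis compares the encoder with an ideal law, in which the index is uniform and the source
has the density given by the codeword. The comparison is one-sided: encoder weight ≤ ideal weight +
excess (`normalize_mul_normalize_le`). The total excess is the soft covering deficit of the two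
layers (`sum_excessWeight`), whose mean over codebooks is at most `T + T_l`
(`lintegral_lintegral_coverWeight_le`).

Under the ideal law both requirements are easy. All pairs (key, message) have equally many indices,
so no pair has mass above `1 / (|K| |W_l|)`, and the actual law of `(K, W_l)` exceeds uniform by no
more than the excess; `log_card_sub_condEntropy_le` turns this into an entropy gap. Also, averaged
over codebooks, the ideal law of codeword and source is dominated by the true law of `(U, S_l,
X_l)`. A competing codeword is independent of the pair, so the usual threshold argument bounds the
confusion probability by `ε` (`lintegral_lintegral_confused_le`).

Neither the codebook ensemble nor the encoder and decoders depend on `γ`, so each bound passes to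
its own infimum. There are `2m` losses, an error loss and a secrecy loss for each terminal. After
division by their mean bounds they sum to at most `2m` on average, so one codebook keeps each within
`2m` times its bound (`exists_le_mul_of_lintegral_le`). -/

namespace OneCommunicator

noncomputable section
open scoped NNReal

/-! ### Likelihood ratios -/

section Ratio

variable {α : Type*} [MeasurableSpace α]

/-- The likelihood ratio `dP/dR`, with value `∞` on the part of `P` singular to `ν`. -/
def ratio (P ν : Measure α) (x : α) : ℝ≥0∞ :=
  P.rnDeriv (P + ν) x / ν.rnDeriv (P + ν) x

/-- The finite part of the likelihood ratio. -/
def finRatio (P ν : Measure α) (x : α) : ℝ≥0 := (ratio P ν x).toNNReal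

lemma measurable_ratio (P ν : Measure α) : Measurable (ratio P ν) :=
  (Measure.measurable_rnDeriv _ _).div (Measure.measurable_rnDeriv _ _)

lemma measurable_finRatio (P ν : Measure α) : Measurable (finRatio P ν) :=
  (measurable_ratio P ν).ennreal_toNNReal

lemma coe_lt_relInfo_iff (P ν : Measure α) (γ : ℝ) (x : α) :
    (γ : EReal) < relInfo P ν x ↔ ENNReal.ofReal (Real.exp γ) < ratio P ν x := by
  rw [← ENNReal.log_lt_log_iff, ENNReal.log_ofReal_of_pos (Real.exp_pos γ), Real.log_exp]
  rfl

variable (P ν : Measure α) [IsFiniteMeasure P] [IsFiniteMeasure ν]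

lemma lintegral_eq_left {g : α → ℝ≥0∞} (hg : Measurable g) :
    ∫⁻ x, P.rnDeriv (P + ν) x * g x ∂(P + ν) = ∫⁻ x, g x ∂P := by
  have h := lintegral_rnDeriv_mul (μ := P) (ν := P + ν)
    (Measure.absolutelyContinuous_of_le (Measure.le_add_right le_rfl)) hg.aemeasurable
  exact h

lemma lintegral_eq_right {g : α → ℝ≥0∞} (hg : Measurable g) :
    ∫⁻ x, ν.rnDeriv (P + ν) x * g x ∂(P + ν) = ∫⁻ x, g x ∂ν := by
  have h := lintegral_rnDeriv_mul (μ := ν) (ν := P + ν)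
    (Measure.absolutelyContinuous_of_le (Measure.le_add_left le_rfl)) hg.aemeasurable
  exact h

/-- If `p`, `q` are the densities of `P`, `ν` with respect to `P + ν`, then `q * (p / q) ≤ p`
everywhere, also where `q = 0`. Only an inequality is available, because the part of `P` singular to
`ν` is lost. -/
lemma lintegral_ratio_mul_le {g : α → ℝ≥0∞} (hg : Measurable g) :
    ∫⁻ x, ratio P ν x * g x ∂ν ≤ ∫⁻ x, g x ∂P := by
  rw [← lintegral_eq_left P ν hg,
    ← lintegral_eq_right P ν (g := fun x => ratio P ν x * g x) ((measurable_ratio P ν).mul hg)]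
  refine lintegral_mono fun x => ?_
  rw [← mul_assoc]
  gcongr
  rw [ratio]
  exact ENNReal.mul_div_le

lemma lintegral_finRatio_mul_le {g : α → ℝ≥0∞} (hg : Measurable g) :
    ∫⁻ x, finRatio P ν x * g x ∂ν ≤ ∫⁻ x, g x ∂P := by
  refine le_trans (lintegral_mono fun x => ?_) (lintegral_ratio_mul_le P ν hg)
  gcongr
  exact ENNReal.coe_toNNReal_le_self

/-- A converse to the domination above: where the ratio is at most `exp γ` it is finite, so `P` has
no singular part there, and replacing the ratio by its finite part loses nothing. -/
lemma measure_relInfo_le (γ : ℝ) :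
    P {x | (γ : EReal) < relInfo P ν x}ᶜ ≤
      ∫⁻ x, {x | finRatio P ν x ≤ Real.exp γ}.indicator
        (fun x => (finRatio P ν x : ℝ≥0∞)) x ∂ν := by
  have hr := measurable_ratio P ν
  have hd := measurable_finRatio P ν
  have hset : {x | (γ : EReal) < relInfo P ν x}ᶜ
      = {x | ratio P ν x ≤ ENNReal.ofReal (Real.exp γ)} := by
    ext x
    simp [coe_lt_relInfo_iff]
  rw [hset]
  have hm : MeasurableSet {x | ratio P ν x ≤ ENNReal.ofReal (Real.exp γ)} :=
    measurableSet_le hr measurable_const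
  have hm' : MeasurableSet {x | (finRatio P ν x : ℝ) ≤ Real.exp γ} :=
    measurableSet_le hd.coe_nnreal_real measurable_const
  rw [← lintegral_indicator_one hm, ← lintegral_eq_left P ν (measurable_one.indicator hm),
    ← lintegral_eq_right P ν ((hd.coe_nnreal_ennreal).indicator hm')]
  refine lintegral_mono_ae ?_
  filter_upwards [ν.rnDeriv_ne_top (P + ν)] with x hx
  by_cases hxs : ratio P ν x ≤ ENNReal.ofReal (Real.exp γ)
  · have hfin : ratio P ν x ≠ ∞ := ne_top_of_le_ne_top ENNReal.ofReal_ne_top hxs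
    have hcoe : (finRatio P ν x : ℝ≥0∞) = ratio P ν x := ENNReal.coe_toNNReal hfin
    have hmem : x ∈ {x | (finRatio P ν x : ℝ) ≤ Real.exp γ} := by
      have := ENNReal.toReal_mono ENNReal.ofReal_ne_top hxs
      rwa [ENNReal.toReal_ofReal (Real.exp_pos γ).le] at this
    rw [Set.indicator_of_mem (show x ∈ {x | ratio P ν x ≤ _} from hxs),
      Set.indicator_of_mem hmem, hcoe]
    simp only [Pi.one_apply, mul_one]
    rw [ratio]
    -- A nonzero number divided by `0` is `∞`, so a finite ratio with zero denominator forces a zero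
    -- numerator.
    by_cases h0 : ν.rnDeriv (P + ν) x = 0
    · have : P.rnDeriv (P + ν) x = 0 := by
        by_contra hne
        exact hfin (by rw [ratio, h0, ENNReal.div_zero hne])
      simp [this]
    · rw [ENNReal.mul_div_cancel h0 hx]
  · rw [Set.indicator_of_notMem (show x ∉ {x | ratio P ν x ≤ _} from hxs)]
    simp

/-- Markov's inequality, since the ratio has `ν`-integral at most `1`. -/
lemma measure_lt_ratio_le [IsProbabilityMeasure P] (τ : ℝ≥0∞) :
    ν {x | τ < ratio P ν x} ≤ τ⁻¹ := by
  have h1 : τ * ν {x | τ ≤ ratio P ν x} ≤ 1 := by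
    refine (mul_meas_ge_le_lintegral (measurable_ratio P ν) τ).trans ?_
    simpa using lintegral_ratio_mul_le P ν (g := fun _ => 1) measurable_const
  rw [mul_comm] at h1
  refine (measure_mono ?_).trans (ENNReal.le_inv_iff_mul_le.2 h1)
  exact Set.ofPred_subset_ofPred.2 fun x hx => le_of_lt hx

end Ratio

/-! ### Kernels -/

section Kernels

variable {α : Type*} [MeasurableSpace α]

/-- The finite product of Markov kernels. -/
def piKernel {ι : Type*} [Fintype ι] {X : ι → Type*} [∀ i, MeasurableSpace (X i)]
    (κ : ∀ i, Kernel α (X i)) [∀ i, IsMarkovKernel (κ i)] : Kernel α (∀ i, X i) where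
  toFun a := Measure.pi fun i => κ i a
  measurable' := by
    refine Measurable.measure_of_isPiSystem_of_isProbabilityMeasure generateFrom_pi.symm
      isPiSystem_pi ?_
    rintro _ ⟨s, hs, rfl⟩
    simp only [Measure.pi_pi]
    refine Finset.measurable_prod _ fun i _ => ?_
    exact (κ i).measurable_coe (hs i (Set.mem_univ i))

lemma piKernel_apply {ι : Type*} [Fintype ι] {X : ι → Type*} [∀ i, MeasurableSpace (X i)]
    (κ : ∀ i, Kernel α (X i)) [∀ i, IsMarkovKernel (κ i)] (a : α) :
    piKernel κ a = Measure.pi fun i => κ i a := rfl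

instance isMarkovKernel_piKernel {ι : Type*} [Fintype ι] {X : ι → Type*}
    [∀ i, MeasurableSpace (X i)] (κ : ∀ i, Kernel α (X i)) [∀ i, IsMarkovKernel (κ i)] :
    IsMarkovKernel (piKernel κ) :=
  ⟨fun a => by rw [piKernel_apply]; infer_instance⟩

/-- The kernel with values in a finite type given by measurable weights. -/
def weightKernel {β : Type*} [Fintype β] [MeasurableSpace β] (w : β → α → ℝ≥0∞)
    (hw : ∀ b, Measurable (w b)) : Kernel α β where
  toFun a := ∑ b, w b a • Measure.dirac b
  measurable' := by
    refine Measure.measurable_of_measurable_coe _ fun s hs => ?_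
    simp only [Measure.coe_finsetSum, Finset.sum_apply, Measure.smul_apply, smul_eq_mul]
    exact Finset.measurable_sum _ fun b _ => (hw b).mul_const _

lemma lintegral_weightKernel {β : Type*} [Fintype β] [MeasurableSpace β]
    [MeasurableSingletonClass β] (w : β → α → ℝ≥0∞) (hw : ∀ b, Measurable (w b)) (a : α)
    (g : β → ℝ≥0∞) : ∫⁻ b, g b ∂weightKernel w hw a = ∑ b, w b a * g b := by
  change ∫⁻ b, g b ∂(∑ b, w b a • Measure.dirac b) = _
  simp [lintegral_finsetSum_measure]

lemma isMarkovKernel_weightKernel {β : Type*} [Fintype β] [MeasurableSpace β]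
    [MeasurableSingletonClass β] (w : β → α → ℝ≥0∞) (hw : ∀ b, Measurable (w b))
    (h1 : ∀ a, ∑ b, w b a = 1) : IsMarkovKernel (weightKernel w hw) :=
  ⟨fun a => ⟨by
    have := lintegral_weightKernel w hw a (fun _ => 1)
    simpa [h1] using this⟩⟩

lemma lintegral_pi_eval {ι : Type*} [Fintype ι] {X : ι → Type*} [∀ i, MeasurableSpace (X i)]
    (μ : ∀ i, Measure (X i)) [∀ i, IsProbabilityMeasure (μ i)] (i : ι) {g : X i → ℝ≥0∞}
    (hg : Measurable g) : ∫⁻ c, g (c i) ∂Measure.pi μ = ∫⁻ x, g x ∂μ i :=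
  (measurePreserving_eval μ i).lintegral_comp hg

lemma lintegral_pi_eval_pair {ι X : Type*} [Fintype ι] [MeasurableSpace X]
    (ν : Measure X) [IsProbabilityMeasure ν] {i j : ι} (hij : i ≠ j) {g : X × X → ℝ≥0∞}
    (hg : Measurable g) :
    ∫⁻ c, g (c i, c j) ∂Measure.pi (fun _ : ι => ν) = ∫⁻ x, ∫⁻ y, g (x, y) ∂ν ∂ν := by
  have hind := (iIndepFun_pi (μ := fun _ : ι => ν) (X := fun _ x => x)
    (fun _ => aemeasurable_id)).indepFun hij
  have hmap := (indepFun_iff_map_prod_eq_prod_map_map (measurable_pi_apply i).aemeasurable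
    (measurable_pi_apply j).aemeasurable).1 hind
  have hi := (measurePreserving_eval (fun _ : ι => ν) i).map_eq
  have hj := (measurePreserving_eval (fun _ : ι => ν) j).map_eq
  rw [show Function.eval i = fun c : ι → X => c i from rfl] at hi
  rw [show Function.eval j = fun c : ι → X => c j from rfl] at hj
  rw [hi, hj] at hmap
  rw [← lintegral_prod _ hg.aemeasurable, ← hmap,
    lintegral_map hg ((measurable_pi_apply i).prodMk (measurable_pi_apply j))]

end Kernels

/-! ### Soft covering -/

section Covering

/-- Only half of `p - y` is estimated by a completed square; the other half is kept exactly and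
averages to zero when `p` is the mean of `y`. This yields the factor `1/2` in the term `exp (γ / 2)
/ (2 √M)`. -/
lemma one_sub_le_quadratic (p y : ℝ) {s : ℝ} (hs : 0 < s) :
    1 - y ≤ (1 - p) + (p - y) / 2 + ((y - p) ^ 2 / (4 * s) + s / 4) := by
  have h : (p - y) / 2 ≤ (y - p) ^ 2 / (4 * s) + s / 4 := by
    have : (y - p) ^ 2 / (4 * s) + s / 4 - (p - y) / 2 = (y - p + s) ^ 2 / (4 * s) := by
      field_simp
      ring
    have h2 : 0 ≤ (y - p + s) ^ 2 / (4 * s) := by positivity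
    linarith
  linarith

/-- Nonnegativity of the majorant lets its `lintegral` be computed as a Bochner integral, without
clipping. -/
lemma quadratic_nonneg {p : ℝ} (hp : p ≤ 1) (y : ℝ) {s : ℝ} (hs : 0 < s) :
    0 ≤ (1 - p) + (p - y) / 2 + ((y - p) ^ 2 / (4 * s) + s / 4) := by
  have h : -((p - y) / 2) ≤ (y - p) ^ 2 / (4 * s) + s / 4 := by
    have : (y - p) ^ 2 / (4 * s) + s / 4 + (p - y) / 2 = (y - p - s) ^ 2 / (4 * s) := by
      field_simp
      ring
    have h2 : 0 ≤ (y - p - s) ^ 2 / (4 * s) := by positivity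
    linarith
  linarith

variable {X ι : Type*} [MeasurableSpace X] [Fintype ι] [Nonempty ι]
  (ν : Measure X) [IsProbabilityMeasure ν]

lemma integral_pi_average {g : X → ℝ} (hg : Integrable g ν) :
    ∫ c, (Fintype.card ι : ℝ)⁻¹ * ∑ i, g (c i) ∂Measure.pi (fun _ : ι => ν) = ∫ x, g x ∂ν := by
  have hmp : ∀ i : ι, MeasurePreserving (fun c : ι → X => c i) (Measure.pi fun _ => ν) ν :=
    fun i => measurePreserving_eval (fun _ : ι => ν) i
  rw [integral_const_mul, integral_finsetSum]
  · have : ∀ i : ι, ∫ c : ι → X, g (c i) ∂Measure.pi (fun _ : ι => ν) = ∫ x, g x ∂ν := by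
      intro i
      rw [← (hmp i).map_eq, integral_map (measurable_pi_apply i).aemeasurable]
      · rw [(hmp i).map_eq]
      · rw [(hmp i).map_eq]
        exact hg.aestronglyMeasurable
    simp only [this, Finset.sum_const, Finset.card_univ, nsmul_eq_mul]
    rw [← mul_assoc, inv_mul_cancel₀ (by simp), one_mul]
  · intro i _
    exact (hmp i).integrable_comp_of_integrable hg

lemma variance_pi_average {g : X → ℝ} (hg : MemLp g 2 ν) :
    Var[fun c => (Fintype.card ι : ℝ)⁻¹ * ∑ i, g (c i); Measure.pi (fun _ : ι => ν)] =
      (Fintype.card ι : ℝ)⁻¹ * Var[g; ν] := by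
  have h := variance_sum_pi (μ := fun _ : ι => ν) (X := fun _ => g) fun _ => hg
  rw [variance_const_mul]
  have h' : (fun c : ι → X => ∑ i, g (c i)) = ∑ i : ι, fun c : ι → X => g (c i) := by
    ext c
    simp
  rw [h', h]
  simp only [Finset.sum_const, Finset.card_univ, nsmul_eq_mul]
  have : (Fintype.card ι : ℝ) ≠ 0 := by simp
  field_simp

/-- One-shot soft covering with a random codebook, for a fixed output symbol. -/
lemma lintegral_pi_one_sub_average_le {f : X → ℝ≥0} (hf : Measurable f)
    (hf1 : ∫⁻ x, f x ∂ν ≤ 1) (γ : ℝ) :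
    ∫⁻ c, (1 - (Fintype.card ι : ℝ≥0∞)⁻¹ * ∑ i, (f (c i) : ℝ≥0∞)) ∂Measure.pi (fun _ : ι => ν) ≤
      (1 - ∫⁻ x, {x | (f x : ℝ) ≤ Real.exp γ}.indicator (fun x => (f x : ℝ≥0∞)) x ∂ν) +
        ENNReal.ofReal (Real.exp (γ / 2) / (2 * Real.sqrt (Fintype.card ι))) := by
  set n : ℝ := (Fintype.card ι : ℝ) with hn
  have hn0 : 0 < n := by simp [hn, Fintype.card_pos]
  have hS : MeasurableSet {x | (f x : ℝ) ≤ Real.exp γ} :=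
    measurableSet_le hf.coe_nnreal_real measurable_const
  -- Truncation at `exp γ` only lowers the average, and it bounds the second moment by `exp γ` times
  -- the mean. The discarded mass reappears as `1 - p`.
  set g : X → ℝ := {x | (f x : ℝ) ≤ Real.exp γ}.indicator (fun x => (f x : ℝ)) with hg
  have hgm : Measurable g := hf.coe_nnreal_real.indicator hS
  have hg0 : ∀ x, 0 ≤ g x := fun x => Set.indicator_nonneg (fun _ _ => NNReal.coe_nonneg _) x
  have hgle : ∀ x, g x ≤ Real.exp γ := by
    intro x
    by_cases hx : x ∈ {x | (f x : ℝ) ≤ Real.exp γ}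
    · rw [hg, Set.indicator_of_mem hx]
      exact hx
    · rw [hg, Set.indicator_of_notMem hx]
      exact (Real.exp_pos _).le
  have hgofReal : ∀ x, ENNReal.ofReal (g x) =
      {x | (f x : ℝ) ≤ Real.exp γ}.indicator (fun x => (f x : ℝ≥0∞)) x := by
    intro x
    by_cases hx : x ∈ {x | (f x : ℝ) ≤ Real.exp γ}
    · rw [hg, Set.indicator_of_mem hx, Set.indicator_of_mem hx, ENNReal.ofReal_coe_nnreal]
    · rw [hg, Set.indicator_of_notMem hx, Set.indicator_of_notMem hx, ENNReal.ofReal_zero]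
  have hmem : ∀ q, MemLp g q ν := fun q =>
    memLp_of_bounded (a := 0) (b := Real.exp γ) (.of_forall fun x => ⟨hg0 x, hgle x⟩)
      hgm.aestronglyMeasurable q
  have hgi : Integrable g ν := memLp_one_iff_integrable.1 (hmem 1)
  set p : ℝ := ∫ x, g x ∂ν with hp
  have hpl : ENNReal.ofReal p =
      ∫⁻ x, {x | (f x : ℝ) ≤ Real.exp γ}.indicator (fun x => (f x : ℝ≥0∞)) x ∂ν := by
    rw [hp, ofReal_integral_eq_lintegral_ofReal hgi (.of_forall hg0)]
    exact lintegral_congr hgofReal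
  have hp0 : 0 ≤ p := integral_nonneg hg0
  have hp1 : p ≤ 1 := by
    have : ENNReal.ofReal p ≤ 1 := by
      rw [hpl]
      refine (lintegral_mono fun x => ?_).trans hf1
      exact Set.indicator_le_self _ _ x
    exact ENNReal.ofReal_le_one.1 this
  set Y : (ι → X) → ℝ := fun c => n⁻¹ * ∑ i, g (c i) with hY
  have hYm : Measurable Y := by
    refine measurable_const.mul (Finset.measurable_sum _ fun i _ => ?_)
    exact hgm.comp (measurable_pi_apply i)
  have hY0 : ∀ c, 0 ≤ Y c := fun c =>
    mul_nonneg (inv_nonneg.2 hn0.le) (Finset.sum_nonneg fun i _ => hg0 _)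
  have hYle : ∀ c, Y c ≤ Real.exp γ := by
    intro c
    have h1 : ∑ i, g (c i) ≤ n * Real.exp γ := by
      refine (Finset.sum_le_sum fun i _ => hgle (c i)).trans ?_
      simp [hn]
    calc Y c ≤ n⁻¹ * (n * Real.exp γ) := by
          exact mul_le_mul_of_nonneg_left h1 (inv_nonneg.2 hn0.le)
      _ = Real.exp γ := by field_simp
  have hYmem : ∀ q, MemLp Y q (Measure.pi fun _ : ι => ν) := fun q =>
    memLp_of_bounded (a := 0) (b := Real.exp γ) (.of_forall fun x => ⟨hY0 x, hYle x⟩)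
      hYm.aestronglyMeasurable q
  have hYi : Integrable Y (Measure.pi fun _ : ι => ν) := memLp_one_iff_integrable.1 (hYmem 1)
  have hYint : ∫ c, Y c ∂Measure.pi (fun _ : ι => ν) = p := integral_pi_average ν hgi
  -- `s ^ 2 = exp γ / n` bounds the variance of the average, which is the choice that balances the
  -- two terms of the quadratic majorant.
  set s : ℝ := Real.exp (γ / 2) / Real.sqrt n with hs
  have hs0 : 0 < s := div_pos (Real.exp_pos _) (Real.sqrt_pos.2 hn0)
  have hs2 : s ^ 2 = n⁻¹ * Real.exp γ := by
    rw [hs, div_pow, Real.sq_sqrt hn0.le, ← Real.exp_nat_mul]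
    rw [div_eq_inv_mul]
    congr 2
    push_cast
    ring
  have hvar : ∫ c, (Y c - p) ^ 2 ∂Measure.pi (fun _ : ι => ν) ≤ s ^ 2 := by
    have h1 := variance_eq_integral (μ := Measure.pi fun _ : ι => ν) hYm.aemeasurable
    rw [hYint] at h1
    rw [← h1, hs2]
    rw [variance_pi_average ν (hmem 2)]
    refine mul_le_mul_of_nonneg_left ?_ (inv_nonneg.2 hn0.le)
    refine (variance_le_expectation_sq hgm.aestronglyMeasurable).trans ?_
    have h2 : ∫ x, (g ^ 2) x ∂ν ≤ ∫ x, Real.exp γ * g x ∂ν := by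
      refine integral_mono ?_ (hgi.const_mul _) fun x => ?_
      · exact (hmem 2).integrable_sq
      · simp only [Pi.pow_apply, pow_two]
        exact mul_le_mul_of_nonneg_right (hgle x) (hg0 x)
    refine h2.trans ?_
    rw [integral_const_mul]
    exact mul_le_of_le_one_right (Real.exp_pos _).le hp1
  have hYsq : Integrable (fun c => (Y c - p) ^ 2) (Measure.pi fun _ : ι => ν) :=
    ((hYmem 2).sub (memLp_const p)).integrable_sq
  have hbound : ∀ c, 1 - (Fintype.card ι : ℝ≥0∞)⁻¹ * ∑ i, (f (c i) : ℝ≥0∞) ≤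
      ENNReal.ofReal ((1 - p) + (p - Y c) / 2 + ((Y c - p) ^ 2 / (4 * s) + s / 4)) := by
    intro c
    have hYc : ENNReal.ofReal (Y c) ≤ (Fintype.card ι : ℝ≥0∞)⁻¹ * ∑ i, (f (c i) : ℝ≥0∞) := by
      rw [hY, ENNReal.ofReal_mul (inv_nonneg.2 hn0.le), ENNReal.ofReal_inv_of_pos hn0, hn,
        ENNReal.ofReal_natCast, ENNReal.ofReal_sum_of_nonneg fun i _ => hg0 _]
      gcongr with i
      rw [hgofReal]
      exact Set.indicator_le_self _ _ _
    refine (tsub_le_tsub_left hYc 1).trans ?_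
    rw [← ENNReal.ofReal_one, ← ENNReal.ofReal_sub _ (hY0 c)]
    exact ENNReal.ofReal_le_ofReal (one_sub_le_quadratic p (Y c) hs0)
  have hi1 : Integrable (fun c => (1 - p) + (p - Y c) / 2) (Measure.pi fun _ : ι => ν) :=
    (integrable_const _).add (((integrable_const p).sub hYi).div_const 2)
  have hi2 : Integrable (fun c => (Y c - p) ^ 2 / (4 * s) + s / 4) (Measure.pi fun _ : ι => ν) :=
    (hYsq.div_const _).add (integrable_const _)
  have hi0 : Integrable (fun c => (p - Y c) / 2) (Measure.pi fun _ : ι => ν) :=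
    ((integrable_const p).sub hYi).div_const 2
  have hi12 : Integrable (fun c => (1 - p) + (p - Y c) / 2 + ((Y c - p) ^ 2 / (4 * s) + s / 4))
      (Measure.pi fun _ : ι => ν) := hi1.add hi2
  refine (lintegral_mono hbound).trans ?_
  rw [← ofReal_integral_eq_lintegral_ofReal hi12
    (.of_forall fun c => quadratic_nonneg hp1 (Y c) hs0), ← hpl, ← ENNReal.ofReal_one,
    ← ENNReal.ofReal_sub _ hp0, ← ENNReal.ofReal_add (by linarith) (by positivity)]
  refine ENNReal.ofReal_le_ofReal ?_
  have hcalc : ∫ c, ((1 - p) + (p - Y c) / 2 + ((Y c - p) ^ 2 / (4 * s) + s / 4))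
      ∂Measure.pi (fun _ : ι => ν) =
      (1 - p) + ((∫ c, (Y c - p) ^ 2 ∂Measure.pi (fun _ : ι => ν)) / (4 * s) + s / 4) := by
    rw [integral_add hi1 hi2, integral_add (integrable_const _)
      hi0, integral_div,
      integral_sub (integrable_const p) hYi, hYint, integral_add (hYsq.div_const _)
      (integrable_const _), integral_div]
    simp
  rw [hcalc]
  have h3 : (∫ c, (Y c - p) ^ 2 ∂Measure.pi (fun _ : ι => ν)) / (4 * s) ≤ s / 4 := by
    rw [div_le_iff₀ (by positivity)]
    refine hvar.trans (le_of_eq ?_)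
    ring
  have h4 : Real.exp (γ / 2) / (2 * Real.sqrt n) = s / 2 := by
    rw [hs]
    field_simp
  rw [h4]
  linarith

/-- One-shot soft covering averaged over the output symbol. -/
lemma lintegral_lintegral_one_sub_average_le {A : Type*} [MeasurableSpace A] (π : Measure A)
    [IsProbabilityMeasure π] (η : Kernel A X) [IsMarkovKernel η] {f : A → X → ℝ≥0}
    (hf : Measurable (Function.uncurry f)) (hf1 : ∀ᵐ a ∂π, ∫⁻ x, f a x ∂η a ≤ 1) (γ : ℝ) :
    ∫⁻ a, ∫⁻ c, (1 - (Fintype.card ι : ℝ≥0∞)⁻¹ * ∑ i, (f a (c i) : ℝ≥0∞))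
        ∂Measure.pi (fun _ : ι => η a) ∂π ≤
      (1 - ∫⁻ a, ∫⁻ x, {x | (f a x : ℝ) ≤ Real.exp γ}.indicator
        (fun x => (f a x : ℝ≥0∞)) x ∂η a ∂π) +
        ENNReal.ofReal (Real.exp (γ / 2) / (2 * Real.sqrt (Fintype.card ι))) := by
  have hmeas : Measurable fun a => ∫⁻ x, {x | (f a x : ℝ) ≤ Real.exp γ}.indicator
        (fun x => (f a x : ℝ≥0∞)) x ∂η a := by
    refine Measurable.lintegral_kernel_prod_right (κ := η)
      (f := fun a x => {x | (f a x : ℝ) ≤ Real.exp γ}.indicator (fun x => (f a x : ℝ≥0∞)) x) ?_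
    have hS : MeasurableSet {q : A × X | ((Function.uncurry f q : ℝ≥0) : ℝ) ≤ Real.exp γ} :=
      measurableSet_le hf.coe_nnreal_real measurable_const
    exact hf.coe_nnreal_ennreal.indicator hS
  have hle : ∀ᵐ a ∂π, ∫⁻ x, {x | (f a x : ℝ) ≤ Real.exp γ}.indicator
        (fun x => (f a x : ℝ≥0∞)) x ∂η a ≤ 1 := by
    filter_upwards [hf1] with a ha
    exact (lintegral_mono fun x => Set.indicator_le_self _ _ x).trans ha
  have hfin : ∫⁻ a, ∫⁻ x, {x | (f a x : ℝ) ≤ Real.exp γ}.indicator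
        (fun x => (f a x : ℝ≥0∞)) x ∂η a ∂π ≠ ∞ := by
    refine ne_top_of_le_ne_top ENNReal.one_ne_top ((lintegral_mono_ae hle).trans ?_)
    simp
  calc _ ≤ ∫⁻ a, ((1 - ∫⁻ x, {x | (f a x : ℝ) ≤ Real.exp γ}.indicator
        (fun x => (f a x : ℝ≥0∞)) x ∂η a) +
        ENNReal.ofReal (Real.exp (γ / 2) / (2 * Real.sqrt (Fintype.card ι)))) ∂π := by
        refine lintegral_mono_ae ?_
        filter_upwards [hf1] with a ha
        exact lintegral_pi_one_sub_average_le (η a) (hf.of_uncurry_left) ha γ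
    _ = _ := by
        rw [lintegral_add_right _ measurable_const, lintegral_sub hmeas hfin hle]
        simp

end Covering

/-! ### Entropy -/

section Entropy

/-- Below `1 / N` the logarithm is nonpositive. Above it, split `x = (x - 1 / N) + 1 / N` and use
`log (x N) ≤ log N` on the first part and `log (x N) ≤ x N - 1` on the second. -/
lemma mul_log_mul_le {x N : ℝ} (hx0 : 0 ≤ x) (hx1 : x ≤ 1) (hN : 1 ≤ N) :
    x * Real.log (x * N) ≤ (1 + Real.log N) * max (x - 1 / N) 0 := by
  have hN0 : 0 < N := by linarith
  have hlog : 0 ≤ Real.log N := Real.log_nonneg hN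
  rcases le_total x (1 / N) with h | h
  · refine le_trans (mul_nonpos_of_nonneg_of_nonpos hx0 ?_)
      (mul_nonneg (by linarith) (le_max_right _ _))
    refine Real.log_nonpos (by positivity) ?_
    rwa [le_div_iff₀ hN0] at h
  · refine le_trans ?_ (mul_le_mul_of_nonneg_left (le_max_left _ _) (by linarith))
    have hx : 0 < x := lt_of_lt_of_le (by positivity) h
    have h1 : Real.log (x * N) ≤ Real.log N :=
      Real.log_le_log (by positivity) (mul_le_of_le_one_left hN0.le hx1)
    have h2 : Real.log (x * N) ≤ x * N - 1 := Real.log_le_sub_one_of_pos (by positivity)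
    have h3 : x * Real.log (x * N) =
        (x - 1 / N) * Real.log (x * N) + (1 / N) * Real.log (x * N) := by ring
    have h4 : (1 / N) * (x * N - 1) = x - 1 / N := by field_simp
    have h5 : (x - 1 / N) * Real.log (x * N) ≤ (x - 1 / N) * Real.log N :=
      mul_le_mul_of_nonneg_left h1 (by linarith)
    have h6 : (1 / N) * Real.log (x * N) ≤ (1 / N) * (x * N - 1) :=
      mul_le_mul_of_nonneg_left h2 (by positivity)
    rw [h3]
    linarith

variable {κ ω : Type*} [Fintype κ] [Fintype ω] [MeasurableSpace κ] [MeasurableSpace ω]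
  [MeasurableSingletonClass ω]

lemma condEntropy_nonneg (P : Measure (κ × ω)) [IsProbabilityMeasure P] : 0 ≤ condEntropy P := by
  refine Finset.sum_nonneg fun w _ => mul_nonneg measureReal_nonneg
    (Finset.sum_nonneg fun k _ => Real.negMulLog_nonneg (by positivity) ?_)
  refine div_le_one_of_le₀ ?_ measureReal_nonneg
  rw [measureReal_def, measureReal_def, Measure.snd_apply (measurableSet_singleton w)]
  exact ENNReal.toReal_mono (measure_ne_top _ _) (measure_mono (by simp))

/-- The gap is the divergence of `P` from uniform × `P_W`. Replacing `P_W` by the uniform law adds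
`log |ω| - H(W) ≥ 0`, and the divergence from the uniform law is bounded termwise by
`mul_log_mul_le`. Only the positive part of the deviation enters, which is what a one-sided covering
bound controls. -/
lemma log_card_sub_condEntropy_le [MeasurableSingletonClass κ] (P : Measure (κ × ω)) [IsProbabilityMeasure P] :
    Real.log (Fintype.card κ) - condEntropy P ≤
      (1 + Real.log (Fintype.card κ * Fintype.card ω)) *
        ∑ p : κ × ω, max (P.real {p} - 1 / (Fintype.card κ * Fintype.card ω)) 0 := by
  have hne : Nonempty (κ × ω) := by
    by_contra h
    rw [not_nonempty_iff] at h
    have := measure_univ (μ := P)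
    rw [Set.univ_eq_empty_iff.2 h] at this
    simp at this
  obtain ⟨k₀, w₀⟩ := hne
  have hκ : (1 : ℝ) ≤ Fintype.card κ := by
    exact_mod_cast Fintype.card_pos_iff.2 ⟨k₀⟩
  have hω : (1 : ℝ) ≤ Fintype.card ω := by
    exact_mod_cast Fintype.card_pos_iff.2 ⟨w₀⟩
  have hN : (1 : ℝ) ≤ Fintype.card κ * Fintype.card ω := by nlinarith
  have hsum : ∑ w : ω, ∑ k : κ, P.real {(k, w)} = 1 := by
    rw [Finset.sum_comm, ← Fintype.sum_prod_type' (f := fun k w => P.real {(k, w)})]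
    simp
  have hsnd : ∀ w, P.snd.real {w} = ∑ k, P.real {(k, w)} := by
    classical
    intro w
    rw [Measure.snd, map_measureReal_apply measurable_snd (measurableSet_singleton w)]
    have : Prod.snd ⁻¹' {w} = ((Finset.univ.image fun k : κ => (k, w) : Finset (κ × ω)) :
        Set (κ × ω)) := by
      ext ⟨k, w'⟩
      simp [eq_comm]
    rw [this, ← sum_measureReal_singleton, Finset.sum_image (by simp [Function.Injective])]
  -- The correction comes from `log y ≤ y - 1` at `y = 1 / (q |ω|)`; summed, it is nonpositive
  -- (`hcorr`), which is the nonnegativity of `log |ω| - H(W)`.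
  have hpoint : ∀ w k, P.real {(k, w)} * Real.log (Fintype.card κ) -
      P.snd.real {w} * Real.negMulLog (P.real {(k, w)} / P.snd.real {w}) ≤
      P.real {(k, w)} * Real.log (P.real {(k, w)} * (Fintype.card κ * Fintype.card ω)) +
        (P.real {(k, w)} / P.snd.real {w} * (1 / Fintype.card ω) - P.real {(k, w)}) := by
    intro w k
    have hx0 : 0 ≤ P.real {(k, w)} := measureReal_nonneg
    have hxq : P.real {(k, w)} ≤ P.snd.real {w} := by
      rw [hsnd]
      exact Finset.single_le_sum (f := fun k => P.real {(k, w)})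
        (fun _ _ => measureReal_nonneg) (Finset.mem_univ k)
    set x := P.real {(k, w)}
    set q := P.snd.real {w}
    rcases hx0.eq_or_lt with h | h
    · simp [← h]
    · have hq : 0 < q := h.trans_le hxq
      have hκ' : (0 : ℝ) < Fintype.card κ := by linarith
      have hω' : (0 : ℝ) < Fintype.card ω := by linarith
      have h1 : Real.log (1 / (q * Fintype.card ω)) ≤ 1 / (q * Fintype.card ω) - 1 :=
        Real.log_le_sub_one_of_pos (by positivity)
      rw [Real.negMulLog, Real.log_div h.ne' hq.ne', Real.log_mul h.ne' (by positivity),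
        Real.log_mul hκ'.ne' hω'.ne']
      rw [one_div, Real.log_inv, Real.log_mul hq.ne' hω'.ne'] at h1
      have h2 := mul_le_mul_of_nonneg_left h1 h.le
      have h3 : q * (-(x / q) * (Real.log x - Real.log q)) =
          -(x * (Real.log x - Real.log q)) := by field_simp
      have h4 : x / q * (1 / Fintype.card ω) = x * (q * Fintype.card ω)⁻¹ := by field_simp
      rw [h3, h4]
      linarith
  -- An inequality, as the quotient is `0` for a message of probability zero.
  have hquot : ∀ w, ∑ k, P.real {(k, w)} / P.snd.real {w} ≤ 1 := by
    intro w
    rw [← Finset.sum_div, ← hsnd]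
    exact div_self_le_one _
  have hcorr : ∑ w : ω, ∑ k : κ,
      (P.real {(k, w)} / P.snd.real {w} * (1 / Fintype.card ω) - P.real {(k, w)}) ≤ 0 := by
    simp only [Finset.sum_sub_distrib, hsum, ← Finset.sum_mul]
    rw [sub_nonpos]
    have : ∑ w : ω, ∑ k : κ, P.real {(k, w)} / P.snd.real {w} ≤ Fintype.card ω := by
      refine (Finset.sum_le_sum fun w _ => hquot w).trans ?_
      simp
    rw [mul_one_div]
    exact (div_le_one (by linarith)).2 this
  have hgap : Real.log (Fintype.card κ) - condEntropy P =
      ∑ w : ω, ∑ k : κ, (P.real {(k, w)} * Real.log (Fintype.card κ) -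
      P.snd.real {w} * Real.negMulLog (P.real {(k, w)} / P.snd.real {w})) := by
    simp only [Finset.sum_sub_distrib, ← Finset.sum_mul, hsum, one_mul, condEntropy,
      Finset.mul_sum]
  rw [hgap]
  calc _ ≤ ∑ w : ω, ∑ k : κ, (P.real {(k, w)} *
          Real.log (P.real {(k, w)} * (Fintype.card κ * Fintype.card ω)) +
        (P.real {(k, w)} / P.snd.real {w} * (1 / Fintype.card ω) - P.real {(k, w)})) :=
        Finset.sum_le_sum fun w _ => Finset.sum_le_sum fun k _ => hpoint w k
    _ ≤ ∑ w : ω, ∑ k : κ, P.real {(k, w)} *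
          Real.log (P.real {(k, w)} * (Fintype.card κ * Fintype.card ω)) := by
        simp only [Finset.sum_add_distrib] at hcorr ⊢
        linarith
    _ ≤ ∑ w : ω, ∑ k : κ, (1 + Real.log (Fintype.card κ * Fintype.card ω)) *
          max (P.real {(k, w)} - 1 / (Fintype.card κ * Fintype.card ω)) 0 :=
        Finset.sum_le_sum fun w _ => Finset.sum_le_sum fun k _ =>
          mul_log_mul_le measureReal_nonneg measureReal_le_one hN
    _ = _ := by
        rw [Finset.sum_comm, Fintype.sum_prod_type, Finset.mul_sum]
        simp only [Finset.mul_sum]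

/-- Terminal comparison between the entropy bound and the form with the slack `δ`. -/
lemma gap_le_of_excess {gap L n a t : ℝ} (M : ℝ) (hM : 1 ≤ M) (hn : 1 ≤ n) (ht : 0 ≤ t)
    (hat : a ≤ t) (hL0 : 0 ≤ L) (hL : L ≤ Real.log n) (hgapL : gap ≤ L)
    (hgap : gap ≤ (1 + L) * (2 * M * a)) {δ : ℝ} (hδ : 0 < δ)
    (hδ' : δ < n ^ (3 / 2 : ℝ) * Real.exp (-1)) :
    gap ≤ 4 * M * (t + 2 * δ) * Real.log (n ^ (3 / 2 : ℝ) / δ) := by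
  have hn0 : 0 < n := by linarith
  have hpow : 0 < n ^ (3 / 2 : ℝ) := Real.rpow_pos_of_pos hn0 _
  have hΛ : Real.log (n ^ (3 / 2 : ℝ) / δ) = 3 / 2 * Real.log n - Real.log δ := by
    rw [Real.log_div hpow.ne' hδ.ne', Real.log_rpow hn0]
  have hΛ1 : 1 ≤ Real.log (n ^ (3 / 2 : ℝ) / δ) := by
    rw [Real.le_log_iff_exp_le (by positivity), le_div_iff₀ hδ]
    have := mul_lt_mul_of_pos_left hδ' (Real.exp_pos 1)
    rw [mul_left_comm, ← Real.exp_add] at this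
    simp only [add_neg_cancel, Real.exp_zero, mul_one] at this
    exact this.le
  set Λ := Real.log (n ^ (3 / 2 : ℝ) / δ)
  have hlogn : 0 ≤ Real.log n := Real.log_nonneg hn
  -- For ordinary `δ` the logarithm `Λ` absorbs the factor `1 + L`, and the slack `2 * δ` is not
  -- needed.
  by_cases h : (1 + L) / 2 ≤ Λ
  · have h1 : (1 + L) * (2 * M * a) ≤ (2 * Λ) * (2 * M * t) := by
      have hMt : 2 * M * a ≤ 2 * M * t := by nlinarith
      have h0 : 0 ≤ 2 * M * t := by positivity
      calc (1 + L) * (2 * M * a) ≤ (1 + L) * (2 * M * t) :=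
            mul_le_mul_of_nonneg_left hMt (by linarith)
        _ ≤ _ := mul_le_mul_of_nonneg_right (by linarith) h0
    have h2 : 0 ≤ 4 * M * (2 * δ) * Λ := by positivity
    linarith
  -- Now `log δ > 3/2 log n - (1 + L) / 2 ≥ L - 1/2`, so `δ > L`, and the trivial bound `gap ≤ L`
  -- suffices because `M, Λ ≥ 1`.
  · push Not at h
    have h1 : Real.log δ ≤ δ - 1 := Real.log_le_sub_one_of_pos hδ
    have h2 : L ≤ δ := by linarith
    have h3 : δ ≤ M * δ := le_mul_of_one_le_left hδ.le hM
    have h4 : M * δ ≤ M * δ * Λ := le_mul_of_one_le_right (by positivity) hΛ1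
    have h5 : 0 ≤ 4 * M * t * Λ := by positivity
    have h6 : 0 ≤ M * δ * Λ := by positivity
    linarith

end Entropy

/-! ### The scheme of a fixed codebook -/

section Normalize

variable {β : Type*} [Fintype β]

/-- The probability weights proportional to `f`, uniform if `f = 0`. -/
def normalize (f : β → ℝ≥0) (b : β) : ℝ≥0 :=
  if ∑ b, f b = 0 then (Fintype.card β : ℝ≥0)⁻¹ else f b / ∑ b, f b

lemma sum_normalize [Nonempty β] (f : β → ℝ≥0) : ∑ b, normalize f b = 1 := by
  unfold normalize
  split_ifs with h
  · simp
  · rw [← Finset.sum_div, div_self h]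

lemma sum_coe_normalize [Nonempty β] (f : β → ℝ≥0) : ∑ b, (normalize f b : ℝ≥0∞) = 1 := by
  exact_mod_cast congrArg (fun x : ℝ≥0 => (x : ℝ≥0∞)) (sum_normalize f)

/-- With `avg` the average of `f`, `normalize f b * avg = f b / |β|` also in the fallback case `f =
0`. Multiply `1 ≤ avg + (1 - avg)` by `normalize f b`, the subtraction being truncated. -/
lemma coe_normalize_le [Nonempty β] (f : β → ℝ≥0) (b : β) :
    (normalize f b : ℝ≥0∞) ≤ (Fintype.card β : ℝ≥0∞)⁻¹ * f b +
      normalize f b * (1 - (Fintype.card β : ℝ≥0∞)⁻¹ * ∑ b, (f b : ℝ≥0∞)) := by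
  have h : normalize f b * ((Fintype.card β : ℝ≥0)⁻¹ * ∑ b, f b) =
      (Fintype.card β : ℝ≥0)⁻¹ * f b := by
    unfold normalize
    split_ifs with h0
    · have : f b = 0 := (Finset.sum_eq_zero_iff.1 h0) b (Finset.mem_univ b)
      simp [h0, this]
    · field_simp
  have hc : (Fintype.card β : ℝ≥0) ≠ 0 := by simp
  have h' : (normalize f b : ℝ≥0∞) * ((Fintype.card β : ℝ≥0∞)⁻¹ * ∑ b, (f b : ℝ≥0∞)) =
      (Fintype.card β : ℝ≥0∞)⁻¹ * f b := by
    have := congrArg (fun x : ℝ≥0 => (x : ℝ≥0∞)) h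
    push_cast [ENNReal.coe_inv hc] at this
    exact this
  rw [← h', ← mul_add]
  conv_lhs => rw [← mul_one (normalize f b : ℝ≥0∞)]
  gcongr
  exact le_add_tsub

lemma measurable_normalize {A : Type*} [MeasurableSpace A] {f : β → A → ℝ≥0}
    (hf : ∀ b, Measurable (f b)) (b : β) : Measurable fun a => normalize (fun b => f b a) b := by
  have hs : Measurable fun a => ∑ b, f b a := Finset.measurable_sum _ fun b _ => hf b
  exact Measurable.ite (hs (measurableSet_singleton 0)) measurable_const ((hf b).div hs)

end Normalize

section Codebook

variable {α : Type*} [Fintype α]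

/-- Some other codeword with the same message is at least as likely as the codeword `(i, j)`. -/
def Confused {B 𝒳 W : Type*} (msg : α → B → W) (r : α → B → 𝒳 → ℝ≥0∞) (i : α) (j : B) : Set 𝒳 :=
  {x | ∃ i', i' ≠ i ∧ msg i' j = msg i j ∧ r i j x ≤ r i' j x}

/-! ### Ideal law, excess and covering loss of a two-layer codebook -/

section Losses

variable {𝒵 B : Type*} [Fintype B]

/-- The loss of soft covering with the two-layer codebook with densities `f` and `h`. -/
def coverWeight (f : α → 𝒵 → ℝ≥0) (h : α → B → 𝒵 → ℝ≥0) (z : 𝒵) : ℝ≥0∞ :=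
  (1 - (Fintype.card α : ℝ≥0∞)⁻¹ * ∑ i, (f i z : ℝ≥0∞)) +
    ∑ i, (Fintype.card α : ℝ≥0∞)⁻¹ * f i z *
      (1 - (Fintype.card B : ℝ≥0∞)⁻¹ * ∑ j, (h i j z : ℝ≥0∞))

/-- The density of the ideal law of the codeword `(i, j)` and the source. -/
def idealWeight (f : α → 𝒵 → ℝ≥0) (h : α → B → 𝒵 → ℝ≥0) (i : α) (j : B) (z : 𝒵) : ℝ≥0∞ :=
  (Fintype.card α : ℝ≥0∞)⁻¹ * (Fintype.card B : ℝ≥0∞)⁻¹ * (f i z * h i j z)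

/-- The excess of the encoder over the ideal law. -/
def excessWeight (f : α → 𝒵 → ℝ≥0) (h : α → B → 𝒵 → ℝ≥0) (i : α) (j : B) (z : 𝒵) :
    ℝ≥0∞ :=
  (Fintype.card α : ℝ≥0∞)⁻¹ * f i z * (normalize (fun j => h i j z) j *
      (1 - (Fintype.card B : ℝ≥0∞)⁻¹ * ∑ j, (h i j z : ℝ≥0∞))) +
    normalize (fun i => f i z) i * (1 - (Fintype.card α : ℝ≥0∞)⁻¹ * ∑ i, (f i z : ℝ≥0∞)) *
      normalize (fun j => h i j z) j

/-- The second layer is expanded only where the first already has its ideal weight. Elsewhere the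
normalized weight is kept, so that the excess sums over `j` exactly. -/
lemma normalize_mul_normalize_le [Nonempty α] [Nonempty B] (f : α → 𝒵 → ℝ≥0) (h : α → B → 𝒵 → ℝ≥0)
    (i : α) (j : B) (z : 𝒵) :
    (normalize (fun i => f i z) i : ℝ≥0∞) * normalize (fun j => h i j z) j ≤
      idealWeight f h i j z + excessWeight f h i j z := by
  have h1 := coe_normalize_le (fun i => f i z) i
  have h2 := coe_normalize_le (fun j => h i j z) j
  calc _ ≤ ((Fintype.card α : ℝ≥0∞)⁻¹ * f i z + normalize (fun i => f i z) i *
          (1 - (Fintype.card α : ℝ≥0∞)⁻¹ * ∑ i, (f i z : ℝ≥0∞))) *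
          normalize (fun j => h i j z) j := by gcongr
    _ = (Fintype.card α : ℝ≥0∞)⁻¹ * f i z * normalize (fun j => h i j z) j +
          normalize (fun i => f i z) i *
          (1 - (Fintype.card α : ℝ≥0∞)⁻¹ * ∑ i, (f i z : ℝ≥0∞)) *
          normalize (fun j => h i j z) j := by rw [add_mul]
    _ ≤ (Fintype.card α : ℝ≥0∞)⁻¹ * f i z * ((Fintype.card B : ℝ≥0∞)⁻¹ * h i j z +
          normalize (fun j => h i j z) j *
          (1 - (Fintype.card B : ℝ≥0∞)⁻¹ * ∑ j, (h i j z : ℝ≥0∞))) +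
          normalize (fun i => f i z) i *
          (1 - (Fintype.card α : ℝ≥0∞)⁻¹ * ∑ i, (f i z : ℝ≥0∞)) *
          normalize (fun j => h i j z) j := by gcongr
    _ = _ := by
        rw [idealWeight, excessWeight]
        ring

lemma sum_excessWeight [Nonempty α] [Nonempty B] (f : α → 𝒵 → ℝ≥0) (h : α → B → 𝒵 → ℝ≥0) (z : 𝒵) :
    ∑ i, ∑ j, excessWeight f h i j z = coverWeight f h z := by
  simp only [excessWeight, Finset.sum_add_distrib, ← Finset.mul_sum, ← Finset.sum_mul,
    sum_coe_normalize, mul_one, one_mul, coverWeight]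
  rw [add_comm]

variable [MeasurableSpace 𝒵]

lemma measurable_idealWeight {f : α → 𝒵 → ℝ≥0} (hf : ∀ i, Measurable (f i))
    {h : α → B → 𝒵 → ℝ≥0} (hh : ∀ i j, Measurable (h i j)) (i : α) (j : B) :
    Measurable (idealWeight f h i j) :=
  measurable_const.mul ((hf i).coe_nnreal_ennreal.mul (hh i j).coe_nnreal_ennreal)

lemma measurable_excessWeight {f : α → 𝒵 → ℝ≥0} (hf : ∀ i, Measurable (f i))
    {h : α → B → 𝒵 → ℝ≥0} (hh : ∀ i j, Measurable (h i j)) (i : α) (j : B) :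
    Measurable (excessWeight f h i j) := by
  have h1 := (measurable_normalize hf i).coe_nnreal_ennreal
  have h2 := (measurable_normalize (fun j => hh i j) j).coe_nnreal_ennreal
  have h3 : Measurable fun z => 1 - (Fintype.card α : ℝ≥0∞)⁻¹ * ∑ i, (f i z : ℝ≥0∞) :=
    measurable_const.sub (measurable_const.mul
      (Finset.measurable_sum _ fun i _ => (hf i).coe_nnreal_ennreal))
  have h4 : Measurable fun z => 1 - (Fintype.card B : ℝ≥0∞)⁻¹ * ∑ j, (h i j z : ℝ≥0∞) :=
    measurable_const.sub (measurable_const.mul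
      (Finset.measurable_sum _ fun j _ => (hh i j).coe_nnreal_ennreal))
  exact ((measurable_const.mul (hf i).coe_nnreal_ennreal).mul (h2.mul h4)).add ((h1.mul h3).mul h2)

end Losses

lemma measurableSet_confused {B 𝒳 W : Type*} [MeasurableSpace 𝒳] (msg : α → B → W)
    {r : α → B → 𝒳 → ℝ≥0∞} (hr : ∀ i j, Measurable (r i j)) (i : α) (j : B) :
    MeasurableSet (Confused msg r i j) := by
  have : Confused msg r i j =
      ⋃ i', {x | i' ≠ i ∧ msg i' j = msg i j ∧ r i j x ≤ r i' j x} := by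
    ext x
    simp [Confused]
  rw [this]
  refine MeasurableSet.iUnion fun i' => ?_
  exact (MeasurableSet.const _).inter ((MeasurableSet.const _).inter
    (measurableSet_le (hr i j) (hr i' j)))

variable [Nonempty α]

/-! ### Maximum likelihood decoding given a message -/

section Decoder

variable {𝒳 B W K : Type*} [Finite B] [MeasurableSpace 𝒳]
  [MeasurableSpace W] [Finite W] [MeasurableSingletonClass W] [MeasurableSpace K]

/-- The maximum likelihood decoder errs only if the codeword is confused with another one. -/
lemma exists_decoder (key : α → K) (msg : α → B → W)
    (hmsg : ∀ i i' j j', msg i j = msg i' j' → j = j')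
    {r : α → B → 𝒳 → ℝ≥0∞} (hr : ∀ i j, Measurable (r i j)) :
    ∃ D : 𝒳 × W → K, Measurable D ∧
      ∀ i j x, D (x, msg i j) ≠ key i → x ∈ Confused msg r i j := by
  classical
  -- The decision uses `x` only through the finite pattern of pairwise comparisons, so measurability
  -- reduces to that of a map from a discrete space. The `else` branch covers message values with no
  -- maximizing codeword, in particular unused ones.
  let G : (α × B → α × B → Prop) × W → K := fun q =>
    if h : ∃ p : α × B, msg p.1 p.2 = q.2 ∧ ∀ p', msg p'.1 p'.2 = q.2 → q.1 p' p then
      key h.choose.1 else key (Classical.arbitrary α)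
  have hpat : Measurable fun x : 𝒳 => fun p p' : α × B => r p.1 p.2 x ≤ r p'.1 p'.2 x := by
    refine measurable_pi_iff.2 fun p => measurable_pi_iff.2 fun p' => ?_
    exact measurableSet_setOfPred.1 (measurableSet_le (hr p.1 p.2) (hr p'.1 p'.2))
  refine ⟨fun q => G (fun p p' => r p.1 p.2 q.1 ≤ r p'.1 p'.2 q.1, q.2), ?_, ?_⟩
  · exact (Measurable.of_discrete (f := G)).comp
      ((hpat.comp measurable_fst).prodMk measurable_snd)
  · intro i j x hne
    have hex : ∃ p : α × B, msg p.1 p.2 = msg i j ∧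
        ∀ p' : α × B, msg p'.1 p'.2 = msg i j → r p'.1 p'.2 x ≤ r p.1 p.2 x := by
      have hfin : ({p : α × B | msg p.1 p.2 = msg i j} : Set (α × B)).Finite := Set.toFinite _
      obtain ⟨p, hp, hmax⟩ := Set.exists_max_image _ (fun p : α × B => r p.1 p.2 x) hfin
        ⟨(i, j), rfl⟩
      exact ⟨p, hp, fun p' hp' => hmax p' hp'⟩
    have hG : G (fun p p' => r p.1 p.2 x ≤ r p'.1 p'.2 x, msg i j) = key hex.choose.1 := dif_pos hex
    simp only [hG] at hne
    obtain ⟨h1, h2⟩ := hex.choose_spec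
    -- The message determines `j`, so a wrong key must come from a different `i` with the same `j`.
    -- Ties count as confusion.
    have hj : hex.choose.2 = j := hmsg _ _ _ _ h1
    refine ⟨hex.choose.1, fun h => hne (by rw [h]), ?_, ?_⟩
    · exact (congrArg (msg hex.choose.1) hj).symm.trans h1
    · have := h2 (i, j) rfl
      rwa [hj] at this

end Decoder

/-! ### The scheme of a codebook and its two losses -/

variable [MeasurableSpace α] [MeasurableSingletonClass α]
  {m : ℕ} {𝒵 : Type*} [MeasurableSpace 𝒵] {𝒳 : Fin m → Type*} [∀ l, MeasurableSpace (𝒳 l)]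
  {B : Fin m → Type*} [∀ l, Fintype (B l)] [∀ l, Nonempty (B l)] [∀ l, MeasurableSpace (B l)]
  [∀ l, MeasurableSingletonClass (B l)]
  {K : Type*} [MeasurableSpace K] [MeasurableSingletonClass K] [Fintype K]
  {W : Fin m → Type*} [∀ l, MeasurableSpace (W l)] [∀ l, MeasurableSingletonClass (W l)]
  [∀ l, Fintype (W l)]

/-- The likelihood encoder as a kernel to codeword indices. -/
lemma exists_index_kernel {f : α → 𝒵 → ℝ≥0} (hf : ∀ i, Measurable (f i))
    {h : ∀ l, α → B l → 𝒵 → ℝ≥0} (hh : ∀ l i j, Measurable (h l i j)) :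
    ∃ κ : Kernel 𝒵 (α × ∀ l, B l), IsMarkovKernel κ ∧
      ∀ l (g : α → B l → ℝ≥0∞) z, ∫⁻ q, g q.1 (q.2 l) ∂κ z =
        ∑ i, ∑ j, (normalize (fun i => f i z) i : ℝ≥0∞) * normalize (fun j => h l i j z) j *
          g i j := by
  have hw1 : ∀ i, Measurable fun z => (normalize (fun i => f i z) i : ℝ≥0∞) := fun i =>
    (measurable_normalize hf i).coe_nnreal_ennreal
  have hw2 : ∀ l (j : B l),
      Measurable fun p : 𝒵 × α => (normalize (fun j => h l p.2 j p.1) j : ℝ≥0∞) := by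
    intro l j
    refine measurable_from_prod_countable_left fun i => ?_
    exact (measurable_normalize (fun j => hh l i j) j).coe_nnreal_ennreal
  have hM1 : IsMarkovKernel (weightKernel _ hw1) :=
    isMarkovKernel_weightKernel _ hw1 fun z => sum_coe_normalize _
  have hM2 : ∀ l, IsMarkovKernel (weightKernel _ (hw2 l)) := fun l =>
    isMarkovKernel_weightKernel _ (hw2 l) fun z => sum_coe_normalize _
  -- Given `z` and `i`, the indices `j_l` are drawn independently over `l`; each terminal's losses
  -- see only `(i, j_l)`.
  refine ⟨weightKernel _ hw1 ⊗ₖ piKernel fun l => weightKernel _ (hw2 l), inferInstance, ?_⟩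
  intro l g z
  rw [Kernel.lintegral_compProd _ _ _ Measurable.of_discrete, lintegral_weightKernel]
  refine Finset.sum_congr rfl fun i _ => ?_
  rw [piKernel_apply, lintegral_pi_eval (fun l => weightKernel _ (hw2 l) (z, i)) l
    (g := fun j => g i j) Measurable.of_discrete, lintegral_weightKernel, Finset.mul_sum]
  exact Finset.sum_congr rfl fun j _ => by rw [mul_assoc]

/-- The likelihood encoder and the maximum likelihood decoders of a codebook with densities `f`
and `h` and decoding metrics `r`. -/
theorem exists_scheme_of_codebook [DecidableEq K] [∀ l, DecidableEq (W l)]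
    (Q : Measure (𝒵 × (∀ l, 𝒳 l))) [IsProbabilityMeasure Q]
    {f : α → 𝒵 → ℝ≥0} (hf : ∀ i, Measurable (f i))
    {h : ∀ l, α → B l → 𝒵 → ℝ≥0} (hh : ∀ l i j, Measurable (h l i j))
    {r : ∀ l, α → B l → 𝒳 l → ℝ≥0∞} (hr : ∀ l i j, Measurable (r l i j))
    (hfh : ∀ l i j, ∫⁻ z, (f i z : ℝ≥0∞) * h l i j z ∂Q.fst ≤ 1)
    (key : α → K) (msg : ∀ l, α → B l → W l)
    (hmsg : ∀ l i i' j j', msg l i j = msg l i' j' → j = j')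
    (hfib : ∀ l k w, ({p : α × B l | key p.1 = k ∧ msg l p.1 p.2 = w} : Finset _).card *
      (Fintype.card K * Fintype.card (W l)) = Fintype.card α * Fintype.card (B l)) :
    ∃ C : KeyScheme 𝒵 𝒳 K W, ∀ l,
      ENNReal.ofReal (C.errorProb Q l) ≤ ∫⁻ z, coverWeight f (h l) z ∂Q.fst +
        ∫⁻ p, ∑ i, ∑ j, idealWeight f (h l) i j p.1 *
          (Confused (msg l) (r l) i j).indicator 1 (p.2 l) ∂Q ∧
      IsProbabilityMeasure (C.lawKW Q l) ∧
      ∑ p : K × W l, (C.lawKW Q l {p} - ((Fintype.card K * Fintype.card (W l) : ℕ) : ℝ≥0∞)⁻¹) ≤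
        ∫⁻ z, coverWeight f (h l) z ∂Q.fst := by
  obtain ⟨κ, hκ, hκint⟩ := exists_index_kernel hf hh
  choose D hD hDerr using fun l => exists_decoder key (msg l) (hmsg l) (hr l)
  let φ : (α × ∀ l, B l) → K × ∀ l, W l := fun q => (key q.1, fun l => msg l q.1 (q.2 l))
  have hφ : Measurable φ := Measurable.of_discrete
  have hMφ : IsMarkovKernel (κ.map φ) := Kernel.IsMarkovKernel.map κ hφ
  refine ⟨⟨κ.map φ, fun l => Kernel.deterministic (D l) (hD l), hMφ, fun l => inferInstance⟩, ?_⟩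
  intro l
  have hle := fun i j z => normalize_mul_normalize_le f (h l) i j z
  have hex := measurable_excessWeight hf (hh l)
  have hid := measurable_idealWeight hf (hh l)
  have hjoint : ∀ G : (𝒵 × ∀ l, 𝒳 l) → α → B l → ℝ≥0∞,
      ∀ F : (𝒵 × ∀ l, 𝒳 l) × (K × ∀ l, W l) → ℝ≥0∞, Measurable F →
      (∀ p i b, F (p, φ (i, b)) = G p i (b l)) →
      ∫⁻ y, F y ∂jointLaw Q (κ.map φ) =
      ∫⁻ p, ∑ i, ∑ j, (normalize (fun i => f i p.1) i : ℝ≥0∞) *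
        normalize (fun j => h l i j p.1) j * G p i j ∂Q := by
    intro G F hF hFG
    rw [jointLaw, Measure.lintegral_compProd hF]
    refine lintegral_congr fun p => ?_
    rw [Kernel.comap_apply, Kernel.lintegral_map (g' := fun b => F (p, b)) _ hφ _
      (hF.comp measurable_prodMk_left),
      ← hκint l (G p) p.1]
    exact lintegral_congr fun q => hFG p q.1 q.2
  have hjointProb : IsProbabilityMeasure (jointLaw Q (κ.map φ)) := by
    unfold jointLaw
    infer_instance
  have hexsum : ∫⁻ p : 𝒵 × (∀ l, 𝒳 l), ∑ i, ∑ j, excessWeight f (h l) i j p.1 ∂Q =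
      ∫⁻ z, coverWeight f (h l) z ∂Q.fst := by
    have : ∀ p : 𝒵 × (∀ l, 𝒳 l), ∑ i, ∑ j, excessWeight f (h l) i j p.1 =
        coverWeight f (h l) p.1 := fun p => sum_excessWeight _ _ _
    have hcw : Measurable (coverWeight f (h l)) := by
      have : coverWeight f (h l) = fun z => ∑ i, ∑ j, excessWeight f (h l) i j z :=
        funext fun z => (sum_excessWeight _ _ z).symm
      rw [this]
      exact Finset.measurable_sum _ fun i _ => Finset.measurable_sum _ fun j _ => hex i j
    rw [lintegral_congr this, Measure.fst, lintegral_map hcw measurable_fst]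
  refine ⟨?_, ?_, ?_⟩
  · rw [KeyScheme.errorProb, measureReal_def, ENNReal.ofReal_toReal]
    swap
    · rw [KeyScheme.lawWithKey]
      have : IsFiniteMeasure (jointLaw Q (κ.map φ)) := inferInstance
      exact measure_ne_top _ _
    have hS : MeasurableSet {p : ((𝒵 × (∀ l, 𝒳 l)) × (K × (∀ l, W l))) × K | p.1.2.1 ≠ p.2} :=
      (measurableSet_eq_fun (by fun_prop) (by fun_prop)).compl
    rw [KeyScheme.lawWithKey, Measure.compProd_apply hS]
    simp only [Kernel.comap_apply]
    have hpre : ∀ y : (𝒵 × (∀ l, 𝒳 l)) × (K × (∀ l, W l)),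
        Kernel.deterministic (D l) (hD l) (y.1.2 l, y.2.2 l) (Prod.mk y ⁻¹' {p | p.1.2.1 ≠ p.2}) =
        {y : (𝒵 × (∀ l, 𝒳 l)) × (K × (∀ l, W l)) | y.2.1 ≠ D l (y.1.2 l, y.2.2 l)}.indicator
          1 y := by
      intro y
      rw [Kernel.deterministic_apply' _ _ (hS.preimage measurable_prodMk_left)]
      simp [Set.indicator_apply]
    simp only [hpre]
    have hS' : MeasurableSet
        {y : (𝒵 × (∀ l, 𝒳 l)) × (K × (∀ l, W l)) | y.2.1 ≠ D l (y.1.2 l, y.2.2 l)} :=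
      (measurableSet_eq_fun (by fun_prop) ((hD l).comp (by fun_prop))).compl
    rw [hjoint (fun p i j => if key i ≠ D l (p.2 l, msg l i j) then 1 else 0) _
      (measurable_one.indicator hS') (fun p i b => by simp [Set.indicator_apply, φ])]
    rw [← hexsum, ← lintegral_add_left]
    swap
    · exact Finset.measurable_sum _ fun i _ => Finset.measurable_sum _ fun j _ =>
        (hex i j).comp measurable_fst
    refine lintegral_mono fun p => ?_
    simp only [← Finset.sum_add_distrib]
    refine Finset.sum_le_sum fun i _ => Finset.sum_le_sum fun j _ => ?_
    -- On the confusion set the encoder weight is split into ideal and excess parts. Off it the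
    -- decoder is correct and the term vanishes.
    by_cases hc : p.2 l ∈ Confused (msg l) (r l) i j
    · rw [Set.indicator_of_mem hc]
      simp only [Pi.one_apply, mul_one]
      rw [add_comm]
      refine le_trans ?_ (hle i j p.1)
      refine mul_le_of_le_one_right' ?_
      split_ifs <;> simp
    · have : ¬ (key i ≠ D l (p.2 l, msg l i j)) := fun hne =>
        hc (hDerr l i j (p.2 l) (Ne.symm hne))
      rw [if_neg this, mul_zero]
      exact zero_le
  · exact Measure.isProbabilityMeasure_map (by fun_prop)
  -- Each index has ideal mass at most `1 / (|α| |B l|)` by `hfh`, and `hfib` puts `|α| |B l| / (|K|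
  -- |W l|)` indices over each pair. Hence the ideal law contributes at most the uniform mass, and
  -- the rest is excess.
  · have hsing : ∀ p : K × W l, KeyScheme.lawKW (𝒳 := 𝒳) ⟨κ.map φ,
        fun l => Kernel.deterministic (D l) (hD l), hMφ, fun l => inferInstance⟩ Q l {p} ≤
        ((Fintype.card K * Fintype.card (W l) : ℕ) : ℝ≥0∞)⁻¹ +
        ∑ i, ∑ j, if (key i, msg l i j) = p then
          ∫⁻ q : 𝒵 × (∀ l, 𝒳 l), excessWeight f (h l) i j q.1 ∂Q else 0 := by
      intro p
      rw [KeyScheme.lawKW, Measure.map_apply (by fun_prop) (measurableSet_singleton p),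
        ← lintegral_indicator_one ((measurableSet_singleton p).preimage (by fun_prop)),
        hjoint (fun _ i j => if (key i, msg l i j) = p then 1 else 0) _
        (measurable_one.indicator ((measurableSet_singleton p).preimage (by fun_prop)))
        (fun q i b => by
          by_cases hp : (key i, msg l i (b l)) = p <;> simp [φ, hp])]
      calc _ ≤ ∫⁻ q : 𝒵 × (∀ l, 𝒳 l), ∑ i, ∑ j, ((if (key i, msg l i j) = p then
              idealWeight f (h l) i j q.1 else 0) + (if (key i, msg l i j) = p then
              excessWeight f (h l) i j q.1 else 0)) ∂Q := by
            refine lintegral_mono fun q => Finset.sum_le_sum fun i _ =>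
              Finset.sum_le_sum fun j _ => ?_
            split_ifs
            · simpa using hle i j q.1
            · simp
        _ = ∑ i, ∑ j, ((if (key i, msg l i j) = p then
              ∫⁻ q : 𝒵 × (∀ l, 𝒳 l), idealWeight f (h l) i j q.1 ∂Q else 0) +
              (if (key i, msg l i j) = p then
              ∫⁻ q : 𝒵 × (∀ l, 𝒳 l), excessWeight f (h l) i j q.1 ∂Q else 0)) := by
            have hm1 : ∀ i j, Measurable fun q : 𝒵 × (∀ l, 𝒳 l) =>
                (if (key i, msg l i j) = p then idealWeight f (h l) i j q.1 else 0) := by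
              intro i j
              split_ifs
              · exact (hid i j).comp measurable_fst
              · exact measurable_const
            have hm2 : ∀ i j, Measurable fun q : 𝒵 × (∀ l, 𝒳 l) =>
                (if (key i, msg l i j) = p then excessWeight f (h l) i j q.1 else 0) := by
              intro i j
              split_ifs
              · exact (hex i j).comp measurable_fst
              · exact measurable_const
            have hm : ∀ i j, Measurable fun q : 𝒵 × (∀ l, 𝒳 l) =>
                ((if (key i, msg l i j) = p then idealWeight f (h l) i j q.1 else 0) +
                  (if (key i, msg l i j) = p then excessWeight f (h l) i j q.1 else 0)) :=
              fun i j => (hm1 i j).add (hm2 i j)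
            rw [lintegral_finsetSum _ fun i _ => Finset.measurable_sum _ fun j _ => hm i j]
            refine Finset.sum_congr rfl fun i _ => ?_
            rw [lintegral_finsetSum _ fun j _ => hm i j]
            refine Finset.sum_congr rfl fun j _ => ?_
            rw [lintegral_add_left (hm1 i j)]
            split_ifs <;> simp
        _ ≤ _ := by
            simp only [Finset.sum_add_distrib]
            gcongr
            have hideal : ∀ i j, ∫⁻ q : 𝒵 × (∀ l, 𝒳 l), idealWeight f (h l) i j q.1 ∂Q ≤
                ((Fintype.card α * Fintype.card (B l) : ℕ) : ℝ≥0∞)⁻¹ := by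
              intro i j
              rw [← lintegral_map (hid i j) measurable_fst]
              simp only [idealWeight]
              have hm : Measurable fun z => (f i z : ℝ≥0∞) * h l i j z :=
                (hf i).coe_nnreal_ennreal.mul (hh l i j).coe_nnreal_ennreal
              rw [lintegral_const_mul _ hm]
              rw [Nat.cast_mul, ENNReal.mul_inv (by simp) (by simp)]
              exact mul_le_of_le_one_right' (hfh l i j)
            calc _ ≤ ∑ i, ∑ j, (if (key i, msg l i j) = p then
                  ((Fintype.card α * Fintype.card (B l) : ℕ) : ℝ≥0∞)⁻¹ else 0) := by
                  refine Finset.sum_le_sum fun i _ => Finset.sum_le_sum fun j _ => ?_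
                  split_ifs
                  · exact hideal i j
                  · exact le_rfl
              _ = (({q : α × B l | key q.1 = p.1 ∧ msg l q.1 q.2 = p.2} : Finset _).card : ℝ≥0∞) *
                  ((Fintype.card α * Fintype.card (B l) : ℕ) : ℝ≥0∞)⁻¹ := by
                  rw [← Fintype.sum_prod_type' (f := fun i j => if (key i, msg l i j) = p then
                    ((Fintype.card α * Fintype.card (B l) : ℕ) : ℝ≥0∞)⁻¹ else 0),
                    ← Finset.sum_filter, Finset.sum_const, nsmul_eq_mul]
                  simp only [Prod.ext_iff]
              _ ≤ _ := by
                  rw [← hfib l p.1 p.2, Nat.cast_mul, ← div_eq_mul_inv]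
                  set a : ℝ≥0∞ :=
                    (({q : α × B l | key q.1 = p.1 ∧ msg l q.1 q.2 = p.2} : Finset _).card : ℝ≥0∞)
                  have hb : ((Fintype.card K * Fintype.card (W l) : ℕ) : ℝ≥0∞) ≠ 0 := by
                    have : Nonempty K := ⟨p.1⟩
                    have : Nonempty (W l) := ⟨p.2⟩
                    simp
                  rw [ENNReal.div_eq_inv_mul, ENNReal.mul_inv (Or.inr (ENNReal.natCast_ne_top _)) (Or.inr hb),
                    mul_comm a⁻¹, mul_assoc]
                  exact mul_le_of_le_one_right' (ENNReal.inv_mul_le_one a)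
    calc _ ≤ ∑ p : K × W l, ∑ i, ∑ j, (if (key i, msg l i j) = p then
          ∫⁻ q : 𝒵 × (∀ l, 𝒳 l), excessWeight f (h l) i j q.1 ∂Q else 0) :=
          Finset.sum_le_sum fun p _ => tsub_le_iff_left.2 (hsing p)
      _ = ∑ i, ∑ j, ∫⁻ q : 𝒵 × (∀ l, 𝒳 l), excessWeight f (h l) i j q.1 ∂Q := by
          rw [Finset.sum_comm]
          refine Finset.sum_congr rfl fun i _ => ?_
          rw [Finset.sum_comm]
          refine Finset.sum_congr rfl fun j _ => ?_
          simp
      _ = _ := by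
          have hm : ∀ i j, Measurable fun q : 𝒵 × (∀ l, 𝒳 l) => excessWeight f (h l) i j q.1 :=
            fun i j => (hex i j).comp measurable_fst
          rw [← hexsum, lintegral_finsetSum _ fun i _ => Finset.measurable_sum _ fun j _ => hm i j]
          refine Finset.sum_congr rfl fun i _ => ?_
          rw [lintegral_finsetSum _ fun j _ => hm i j]

end Codebook

/-! ### Averages over random codebooks -/

/-- For passing to the infimum over `γ`: the averaged loss on the left does not involve `γ`. -/
lemma le_ofReal_iInf {ι : Type*} [Nonempty ι] {x : ℝ≥0∞} {a : ι → ℝ} (ha : ∀ i, 0 ≤ a i)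
    (h : ∀ i, x ≤ ENNReal.ofReal (a i)) : x ≤ ENNReal.ofReal (⨅ i, a i) := by
  have hx : x ≠ ∞ := ne_top_of_le_ne_top ENNReal.ofReal_ne_top (h (Classical.arbitrary ι))
  rw [← ENNReal.ofReal_toReal hx]
  refine ENNReal.ofReal_le_ofReal (le_ciInf fun i => ?_)
  exact ENNReal.toReal_le_of_le_ofReal (ha i) (h i)

/-- Each `φ k / a k` has mean at most `1`, so their sum is at most the number of losses at some
point outside the exceptional null set, and so is every summand. The conventions for `0⁻¹` cover `a
k = 0`. -/
lemma exists_le_mul_of_lintegral_le {Ω ι : Type*} [MeasurableSpace Ω] [Fintype ι] (P : Measure Ω)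
    [IsProbabilityMeasure P] {φ : ι → Ω → ℝ≥0∞} (hφ : ∀ k, Measurable (φ k)) {a : ι → ℝ≥0∞}
    (ha : ∀ k, a k ≠ ∞) (h : ∀ k, ∫⁻ c, φ k c ∂P ≤ a k) {p : Ω → Prop} (hp : ∀ᵐ c ∂P, p c) :
    ∃ c, p c ∧ ∀ k, φ k c ≤ Fintype.card ι * a k := by
  have hm : Measurable fun c => ∑ k, (a k)⁻¹ * φ k c :=
    Finset.measurable_sum _ fun k _ => (hφ k).const_mul _
  obtain ⟨c, hc, hle⟩ := exists_notMem_null_le_lintegral hm.aemeasurable (ae_iff.1 hp)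
  refine ⟨c, by simpa using hc, fun k => ?_⟩
  have hsum : ∫⁻ c, ∑ k, (a k)⁻¹ * φ k c ∂P ≤ Fintype.card ι := by
    rw [lintegral_finsetSum _ fun k _ => (hφ k).const_mul _]
    refine (Finset.sum_le_sum (g := fun _ => 1) fun k _ => ?_).trans (by simp)
    rw [lintegral_const_mul _ (hφ k)]
    exact (mul_le_mul_right (h k) _).trans (ENNReal.inv_mul_le_one _)
  have hk : φ k c / a k ≤ Fintype.card ι := by
    rw [ENNReal.div_eq_inv_mul]
    refine le_trans ?_ (hle.trans hsum)
    exact Finset.single_le_sum (f := fun k => (a k)⁻¹ * φ k c) (fun _ _ => zero_le)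
      (Finset.mem_univ k)
  exact (ENNReal.div_le_iff_le_mul (Or.inr (ENNReal.natCast_ne_top _)) (Or.inl (ha k))).1 hk

lemma coveringTerm_nonneg {Ω : Type*} [MeasurableSpace Ω] (P : Measure Ω) (i : Ω → EReal) (M : ℕ) :
    0 ≤ coveringTerm P i M :=
  Real.iInf_nonneg fun _ => add_nonneg measureReal_nonneg (by positivity)

/-- Soft covering in terms of the relative information, for a reference measure `ν` that is the
image under `e` of a composition `π ⊗ η` whose first marginal is that of `P`. -/
lemma lintegral_covering_le {Ω A X ι : Type*} [MeasurableSpace Ω] [MeasurableSpace A]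
    [MeasurableSpace X] [Fintype ι] [Nonempty ι] (P ν : Measure Ω) [IsProbabilityMeasure P]
    [IsFiniteMeasure ν] (π : Measure A) [IsProbabilityMeasure π] (η : Kernel A X)
    [IsMarkovKernel η] {e : A → X → Ω} (he : Measurable (Function.uncurry e)) {p : Ω → A}
    (hp : Measurable p) (hpe : ∀ a x, p (e a x) = a) (hP : P.map p = π)
    (hν : ∀ g : Ω → ℝ≥0∞, Measurable g → ∫⁻ w, g w ∂ν = ∫⁻ a, ∫⁻ x, g (e a x) ∂η a ∂π) :
    ∫⁻ a, ∫⁻ c, (1 - (Fintype.card ι : ℝ≥0∞)⁻¹ * ∑ i, (finRatio P ν (e a (c i)) : ℝ≥0∞))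
        ∂Measure.pi (fun _ : ι => η a) ∂π ≤
      ENNReal.ofReal (coveringTerm P (relInfo P ν) (Fintype.card ι)) := by
  have hd := measurable_finRatio P ν
  have hf : Measurable (Function.uncurry fun a x => finRatio P ν (e a x)) := hd.comp he
  -- Domination of `finRatio · ν` by `P`, tested on the sets `p ⁻¹' s`, compares the fibre integrals
  -- with the common marginal `π`; for almost every `a` the fibre ratio is therefore a
  -- subprobability density.
  have hf1 : ∀ᵐ a ∂π, ∫⁻ x, finRatio P ν (e a x) ∂η a ≤ 1 := by
    refine ae_le_of_forall_setLIntegral_le_of_sigmaFinite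
      (Measurable.lintegral_kernel_prod_right hf.coe_nnreal_ennreal) fun s hs _ => ?_
    have h1 := lintegral_finRatio_mul_le P ν (g := fun w => s.indicator 1 (p w))
      ((measurable_one.indicator hs).comp hp)
    rw [hν (fun w => finRatio P ν w * s.indicator 1 (p w))
      (hd.coe_nnreal_ennreal.mul ((measurable_one.indicator hs).comp hp))] at h1
    simp only [hpe] at h1
    rw [← lintegral_map (f := s.indicator 1) (measurable_one.indicator hs) hp, hP] at h1
    rw [← lintegral_indicator hs, ← lintegral_indicator hs]
    refine le_trans (le_of_eq ?_) h1
    refine lintegral_congr fun a => ?_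
    have hm : Measurable fun x => (finRatio P ν (e a x) : ℝ≥0∞) :=
      (hd.comp he.of_uncurry_left).coe_nnreal_ennreal
    rw [lintegral_mul_const _ hm]
    by_cases ha : a ∈ s <;> simp [ha]
  refine le_ofReal_iInf (fun γ => add_nonneg measureReal_nonneg (by positivity)) fun γ => ?_
  refine (lintegral_lintegral_one_sub_average_le π η hf hf1 γ).trans ?_
  rw [ENNReal.ofReal_add measureReal_nonneg (by positivity), ofReal_measureReal]
  gcongr
  have hS : MeasurableSet {w | (finRatio P ν w : ℝ) ≤ Real.exp γ} :=
    measurableSet_le hd.coe_nnreal_real measurable_const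
  have h1 := measure_relInfo_le P ν γ
  rw [hν _ (hd.coe_nnreal_ennreal.indicator hS)] at h1
  have hS' : MeasurableSet {x | (γ : EReal) < relInfo P ν x} := by
    simp only [coe_lt_relInfo_iff]
    exact measurableSet_lt measurable_const (measurable_ratio P ν)
  rw [tsub_le_iff_right, ← prob_add_prob_compl (μ := P) hS']
  gcongr
  exact h1

lemma decoding_le {A X : Type*} [MeasurableSpace A] [MeasurableSpace X] (P : Measure (A × X))
    [IsProbabilityMeasure P] (M : ℕ) {x : ℝ≥0∞}
    (hx : ∀ τ : ℝ≥0∞, x ≤ P {w | ratio P (P.fst.prod P.snd) w ≤ τ} +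
      (M - 1 : ℕ) * (P.fst.prod P.snd) {w | τ < ratio P (P.fst.prod P.snd) w}) :
    x ≤ ENNReal.ofReal (decodingTerm P (infoDensity P) M) := by
  refine le_ofReal_iInf (fun γ => add_nonneg measureReal_nonneg (Real.exp_pos _).le) fun γ => ?_
  -- At the threshold `(M - 1) exp γ` Markov's bound cancels the number of competitors and leaves
  -- `exp (-γ)`.
  refine (hx ((M - 1 : ℕ) * ENNReal.ofReal (Real.exp γ))).trans ?_
  rw [ENNReal.ofReal_add measureReal_nonneg (Real.exp_pos _).le, ofReal_measureReal]
  refine add_le_add (measure_mono ?_) ?_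
  · intro w hw
    change infoDensity P w ≤ _
    have hw' : ratio P (P.fst.prod P.snd) w ≤ (M - 1 : ℕ) * ENNReal.ofReal (Real.exp γ) := hw
    have := ENNReal.log_le_log hw'
    rwa [ENNReal.log_mul_add, ENNReal.log_ofReal_of_pos (Real.exp_pos γ), Real.log_exp] at this
  · refine (mul_le_mul_right (measure_lt_ratio_le P (P.fst.prod P.snd) _) _).trans ?_
    -- Without competitors the threshold is `0`, matching `log 0 = ⊥`, and the second term vanishes.
    rcases Nat.eq_zero_or_pos (M - 1) with h | h
    · simp [h]
    · have h0 : ((M - 1 : ℕ) : ℝ≥0∞) ≠ 0 := by exact_mod_cast h.ne'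
      rw [ENNReal.mul_inv (Or.inl h0) (Or.inl (ENNReal.natCast_ne_top _)), ← mul_assoc,
        ENNReal.mul_inv_cancel h0 (ENNReal.natCast_ne_top _), one_mul,
        ← ENNReal.ofReal_inv_of_pos (Real.exp_pos γ), Real.exp_neg]

/-! ### The laws of the source and the auxiliary variables -/

lemma lintegral_comp_fst {𝒵 Y : Type*} [MeasurableSpace 𝒵] [MeasurableSpace Y] (Q : Measure (𝒵 × Y)) {g : 𝒵 → ℝ≥0∞} (hg : Measurable g) :
    ∫⁻ p, g p.1 ∂Q = ∫⁻ z, g z ∂Q.fst := by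
  rw [Measure.fst, lintegral_map hg measurable_fst]

section DensUZ

variable {m : ℕ} {𝒵 : Type*} [MeasurableSpace 𝒵] {𝒳 : Fin m → Type*} [∀ l, MeasurableSpace (𝒳 l)]
  {𝒰 : Type*} [MeasurableSpace 𝒰] (Q : Measure (𝒵 × (∀ l, 𝒳 l)))

/-- The density of `(U, Z)` with respect to the product law. -/
def densUZ (QU : Kernel 𝒵 𝒰) (u : 𝒰) (z : 𝒵) : ℝ≥0 :=
  finRatio (lawUZ Q QU) ((lawUZ Q QU).fst.prod (lawUZ Q QU).snd) (u, z)

lemma measurable_densUZ (QU : Kernel 𝒵 𝒰) :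
    Measurable (Function.uncurry (densUZ Q QU)) := measurable_finRatio _ _

lemma measurable_densUZ_comp (QU : Kernel 𝒵 𝒰) {C : Type*} [MeasurableSpace C] {φ : C → 𝒰}
    (hφ : Measurable φ) : Measurable fun q : C × 𝒵 => (densUZ Q QU (φ q.1) q.2 : ℝ≥0∞) :=
  ((measurable_densUZ Q QU).comp (f := fun q : C × 𝒵 => (φ q.1, q.2))
    (by fun_prop)).coe_nnreal_ennreal

end DensUZ

section Laws

variable {m : ℕ} {𝒵 : Type*} [MeasurableSpace 𝒵] {𝒳 : Fin m → Type*} [∀ l, MeasurableSpace (𝒳 l)]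
  {𝒰 𝒮 : Type*} [MeasurableSpace 𝒰] [MeasurableSpace 𝒮]
  (Q : Measure (𝒵 × (∀ l, 𝒳 l))) [IsProbabilityMeasure Q]

lemma lintegral_jointLaw {α : Type*} [MeasurableSpace α] (κ : Kernel 𝒵 α) [IsSFiniteKernel κ]
    {g : (𝒵 × (∀ l, 𝒳 l)) × α → ℝ≥0∞} (hg : Measurable g) :
    ∫⁻ y, g y ∂jointLaw Q κ = ∫⁻ p, ∫⁻ a, g (p, a) ∂κ p.1 ∂Q := by
  rw [jointLaw, Measure.lintegral_compProd hg]
  rfl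

lemma lintegral_lawUZ (QU : Kernel 𝒵 𝒰) [IsSFiniteKernel QU] {g : 𝒰 × 𝒵 → ℝ≥0∞}
    (hg : Measurable g) :
    ∫⁻ y, g y ∂lawUZ Q QU = ∫⁻ z, ∫⁻ u, g (u, z) ∂QU z ∂Q.fst := by
  rw [lawUZ, lintegral_map hg (by fun_prop), lintegral_jointLaw Q QU (by fun_prop)]
  exact lintegral_comp_fst Q (g := fun z => ∫⁻ u, g (u, z) ∂QU z)
    (Measurable.lintegral_kernel_prod_right (f := fun z u => g (u, z)) (by fun_prop))

lemma lintegral_lawUSZ (κ : Kernel 𝒵 (𝒰 × 𝒮)) [IsSFiniteKernel κ] {g : 𝒰 × 𝒮 × 𝒵 → ℝ≥0∞}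
    (hg : Measurable g) :
    ∫⁻ y, g y ∂lawUSZ Q κ = ∫⁻ z, ∫⁻ a, g (a.1, a.2, z) ∂κ z ∂Q.fst := by
  rw [lawUSZ, lintegral_map hg (by fun_prop), lintegral_jointLaw Q κ (by fun_prop)]
  exact lintegral_comp_fst Q (g := fun z => ∫⁻ a, g (a.1, a.2, z) ∂κ z)
    (Measurable.lintegral_kernel_prod_right (f := fun z (a : 𝒰 × 𝒮) => g (a.1, a.2, z))
      (by fun_prop))

lemma lintegral_lawUSX (κ : Kernel 𝒵 (𝒰 × 𝒮)) [IsSFiniteKernel κ] (l : Fin m)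
    {g : (𝒰 × 𝒮) × 𝒳 l → ℝ≥0∞} (hg : Measurable g) :
    ∫⁻ y, g y ∂lawUSX Q κ l = ∫⁻ p, ∫⁻ a, g (a, p.2 l) ∂κ p.1 ∂Q := by
  rw [lawUSX, lintegral_map hg (by fun_prop), lintegral_jointLaw Q κ (by fun_prop)]

instance isProbabilityMeasure_lawUZ (QU : Kernel 𝒵 𝒰) [IsMarkovKernel QU] :
    IsProbabilityMeasure (lawUZ Q QU) := by
  unfold lawUZ jointLaw
  exact Measure.isProbabilityMeasure_map (by fun_prop)

instance isProbabilityMeasure_lawUSZ (κ : Kernel 𝒵 (𝒰 × 𝒮)) [IsMarkovKernel κ] :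
    IsProbabilityMeasure (lawUSZ Q κ) := by
  unfold lawUSZ jointLaw
  exact Measure.isProbabilityMeasure_map (by fun_prop)

instance isProbabilityMeasure_lawUSX (κ : Kernel 𝒵 (𝒰 × 𝒮)) [IsMarkovKernel κ] (l : Fin m) :
    IsProbabilityMeasure (lawUSX Q κ l) := by
  unfold lawUSX jointLaw
  exact Measure.isProbabilityMeasure_map (by fun_prop)

lemma snd_lawUZ (QU : Kernel 𝒵 𝒰) [IsMarkovKernel QU] : (lawUZ Q QU).snd = Q.fst := by
  refine Measure.ext_of_lintegral _ fun g hg => ?_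
  rw [Measure.snd, lintegral_map hg measurable_snd, lintegral_lawUZ Q QU (by fun_prop)]
  simp

lemma lintegral_densUZ_le (QU : Kernel 𝒵 𝒰) [IsMarkovKernel QU] {g : 𝒰 → 𝒵 → ℝ≥0∞} (hg : Measurable (Function.uncurry g)) :
    ∫⁻ u, ∫⁻ z, densUZ Q QU u z * g u z ∂Q.fst ∂(lawUZ Q QU).fst ≤
      ∫⁻ p, g p.1 p.2 ∂lawUZ Q QU := by
  have h := lintegral_finRatio_mul_le (lawUZ Q QU) ((lawUZ Q QU).fst.prod (lawUZ Q QU).snd) hg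
  rw [lintegral_prod] at h
  · rw [snd_lawUZ] at h
    unfold densUZ
    rw [snd_lawUZ]
    exact h
  · exact ((measurable_finRatio _ _).coe_nnreal_ennreal.mul hg).aemeasurable

/-- The law of `(U, S)`. -/
def lawUS (κ : Kernel 𝒵 (𝒰 × 𝒮)) : Measure (𝒰 × 𝒮) :=
  (lawUSZ Q κ).map fun p => (p.1, p.2.1)

instance isProbabilityMeasure_lawUS (κ : Kernel 𝒵 (𝒰 × 𝒮)) [IsMarkovKernel κ] :
    IsProbabilityMeasure (lawUS Q κ) :=
  Measure.isProbabilityMeasure_map (by fun_prop)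

lemma lintegral_lawUS (κ : Kernel 𝒵 (𝒰 × 𝒮)) [IsSFiniteKernel κ] {g : 𝒰 × 𝒮 → ℝ≥0∞}
    (hg : Measurable g) :
    ∫⁻ y, g y ∂lawUS Q κ = ∫⁻ z, ∫⁻ a, g a ∂κ z ∂Q.fst := by
  rw [lawUS, lintegral_map hg (by fun_prop), lintegral_lawUSZ Q κ (by fun_prop)]

lemma fst_lawUSX (κ : Kernel 𝒵 (𝒰 × 𝒮)) [IsMarkovKernel κ] (l : Fin m) :
    (lawUSX Q κ l).fst = lawUS Q κ := by
  refine Measure.ext_of_lintegral _ fun g hg => ?_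
  rw [Measure.fst, lintegral_map hg measurable_fst, lintegral_lawUSX Q κ l (by fun_prop),
    lintegral_lawUS Q κ hg]
  exact lintegral_comp_fst Q (g := fun z => ∫⁻ a, g a ∂κ z) hg.lintegral_kernel

variable {QU : Kernel 𝒵 𝒰} [IsMarkovKernel QU] {κ : Kernel 𝒵 (𝒰 × 𝒮)} [IsMarkovKernel κ]

/-- Here the common `U`-marginal enters: one family of centres serves all terminals. -/
lemma map_lawUSZ (hκ : ∀ᵐ z ∂Q.fst, (κ z).fst = QU z) :
    (lawUSZ Q κ).map (fun p => (p.1, p.2.2)) = lawUZ Q QU := by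
  refine Measure.ext_of_lintegral _ fun g hg => ?_
  rw [lintegral_map hg (by fun_prop), lintegral_lawUSZ Q κ (by fun_prop), lintegral_lawUZ Q QU hg]
  refine lintegral_congr_ae ?_
  filter_upwards [hκ] with z hz
  rw [← hz, Measure.fst, lintegral_map (f := fun u => g (u, z)) (by fun_prop) measurable_fst]

lemma fst_lawUSZ (hκ : ∀ᵐ z ∂Q.fst, (κ z).fst = QU z) : (lawUSZ Q κ).fst = (lawUZ Q QU).fst := by
  rw [← map_lawUSZ Q hκ, Measure.fst, Measure.fst, Measure.map_map measurable_fst (by fun_prop)]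
  rfl

lemma fst_lawUS (hκ : ∀ᵐ z ∂Q.fst, (κ z).fst = QU z) : (lawUS Q κ).fst = (lawUZ Q QU).fst := by
  rw [← fst_lawUSZ Q hκ, Measure.fst, Measure.fst, lawUS,
    Measure.map_map measurable_fst (by fun_prop)]
  rfl

variable [StandardBorelSpace 𝒮] [Nonempty 𝒮]

lemma lintegral_lawUS_eq (hκ : ∀ᵐ z ∂Q.fst, (κ z).fst = QU z) {g : 𝒰 × 𝒮 → ℝ≥0∞}
    (hg : Measurable g) :
    ∫⁻ a, g a ∂lawUS Q κ =
      ∫⁻ u, ∫⁻ s, g (u, s) ∂(lawUS Q κ).condKernel u ∂(lawUZ Q QU).fst := by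
  rw [← fst_lawUS Q hκ, Measure.lintegral_condKernel hg]

variable [StandardBorelSpace 𝒵] [Nonempty 𝒵]

/-- The reference law `P_U P_{S|U} P_{Z|U}`. -/
def refLaw (κ : Kernel 𝒵 (𝒰 × 𝒮)) [IsMarkovKernel κ] : Measure (𝒰 × 𝒮 × 𝒵) :=
  (lawUSZ Q κ).fst ⊗ₘ ((lawUS Q κ).condKernel ×ₖ
    ((lawUSZ Q κ).map (fun p => (p.1, p.2.2))).condKernel)

instance isFiniteMeasure_refLaw : IsFiniteMeasure (refLaw Q κ) := by
  unfold refLaw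
  infer_instance

/-- Conditional independence of `S` and `Z` given `U` lets the reference law be read as `(U, Z)`
first and then `S` from `P_{S|U}`. This is how satellites are drawn, so soft covering applies for
each fixed `(u, z)`. -/
lemma lintegral_refLaw (hκ : ∀ᵐ z ∂Q.fst, (κ z).fst = QU z) {g : 𝒰 × 𝒮 × 𝒵 → ℝ≥0∞}
    (hg : Measurable g) :
    ∫⁻ w, g w ∂refLaw Q κ =
      ∫⁻ p, ∫⁻ s, g (p.1, s, p.2) ∂(lawUS Q κ).condKernel p.1 ∂lawUZ Q QU := by
  have hm : Measurable fun p : 𝒰 × 𝒵 => ∫⁻ s, g (p.1, s, p.2) ∂(lawUS Q κ).condKernel p.1 :=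
    Measurable.lintegral_kernel_prod_right (κ := (lawUS Q κ).condKernel.comap Prod.fst
      measurable_fst) (f := fun (p : 𝒰 × 𝒵) s => g (p.1, s, p.2)) (by fun_prop)
  have hfst : ((lawUSZ Q κ).map fun p => (p.1, p.2.2)).fst = (lawUSZ Q κ).fst := by
    rw [map_lawUSZ Q hκ, fst_lawUSZ Q hκ]
  rw [refLaw, Measure.lintegral_compProd hg, ← map_lawUSZ Q hκ, ← Measure.lintegral_condKernel hm,
    hfst]
  refine lintegral_congr fun u => ?_
  rw [Kernel.prod_apply, lintegral_prod_symm' _ (by fun_prop)]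

/-- The density of `(U, S, Z)` with respect to `P_U P_{S|U} P_{Z|U}`. -/
def densUSZ (κ : Kernel 𝒵 (𝒰 × 𝒮)) [IsMarkovKernel κ] (a : 𝒰 × 𝒮) (z : 𝒵) : ℝ≥0 :=
  finRatio (lawUSZ Q κ) (refLaw Q κ) (a.1, a.2, z)

lemma measurable_densUSZ (κ : Kernel 𝒵 (𝒰 × 𝒮)) [IsMarkovKernel κ] :
    Measurable (Function.uncurry (densUSZ Q κ)) :=
  (measurable_finRatio _ _).comp (f := fun q : (𝒰 × 𝒮) × 𝒵 => (q.1.1, q.1.2, q.2)) (by fun_prop)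

lemma measurable_densUSZ_comp (κ : Kernel 𝒵 (𝒰 × 𝒮)) [IsMarkovKernel κ] {C : Type*}
    [MeasurableSpace C] {φ : C → 𝒰 × 𝒮} (hφ : Measurable φ) :
    Measurable fun q : C × 𝒵 => (densUSZ Q κ (φ q.1) q.2 : ℝ≥0∞) :=
  ((measurable_densUSZ Q κ).comp (f := fun q : C × 𝒵 => (φ q.1, q.2))
    (by fun_prop)).coe_nnreal_ennreal

lemma lintegral_densUSZ_le (hκ : ∀ᵐ z ∂Q.fst, (κ z).fst = QU z) {g : 𝒰 × 𝒮 → 𝒵 → ℝ≥0∞}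
    (hg : Measurable (Function.uncurry g)) :
    ∫⁻ p, ∫⁻ s, densUSZ Q κ (p.1, s) p.2 * g (p.1, s) p.2 ∂(lawUS Q κ).condKernel p.1
      ∂lawUZ Q QU ≤ ∫⁻ w, g (w.1, w.2.1) w.2.2 ∂lawUSZ Q κ := by
  have hg' : Measurable fun w : 𝒰 × 𝒮 × 𝒵 => g (w.1, w.2.1) w.2.2 :=
    hg.comp (f := fun w : 𝒰 × 𝒮 × 𝒵 => ((w.1, w.2.1), w.2.2)) (by fun_prop)
  have h := lintegral_finRatio_mul_le (lawUSZ Q κ) (refLaw Q κ) hg'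
  rwa [lintegral_refLaw Q hκ
    (g := fun w => finRatio (lawUSZ Q κ) (refLaw Q κ) w * g (w.1, w.2.1) w.2.2)
    ((measurable_finRatio _ _).coe_nnreal_ennreal.mul hg')] at h

/-- The ideal law of the codeword and the source is dominated by the true law. -/
lemma lintegral_densUZ_mul_densUSZ_le (hκ : ∀ᵐ z ∂Q.fst, (κ z).fst = QU z)
    {g : 𝒰 × 𝒮 → 𝒵 → ℝ≥0∞} (hg : Measurable (Function.uncurry g)) :
    ∫⁻ a, ∫⁻ z, densUZ Q QU a.1 z * densUSZ Q κ a z * g a z ∂Q.fst ∂lawUS Q κ ≤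
      ∫⁻ w, g (w.1, w.2.1) w.2.2 ∂lawUSZ Q κ := by
  have hf := (measurable_densUZ Q QU).coe_nnreal_ennreal
  have hh := (measurable_densUSZ Q κ).coe_nnreal_ennreal
  have hf' : Measurable fun q : (𝒰 × 𝒮) × 𝒵 => (densUZ Q QU q.1.1 q.2 : ℝ≥0∞) :=
    hf.comp (f := fun q : (𝒰 × 𝒮) × 𝒵 => (q.1.1, q.2)) (by fun_prop)
  have hhg : Measurable fun q : (𝒰 × 𝒮) × 𝒵 => (densUSZ Q κ q.1 q.2 : ℝ≥0∞) * g q.1 q.2 :=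
    hh.mul hg
  have hfhg : Measurable fun q : (𝒰 × 𝒮) × 𝒵 =>
      (densUZ Q QU q.1.1 q.2 : ℝ≥0∞) * densUSZ Q κ q.1 q.2 * g q.1 q.2 := (hf'.mul hh).mul hg
  have hΦ : Measurable (Function.uncurry fun (u : 𝒰) (z : 𝒵) =>
      ∫⁻ s, densUSZ Q κ (u, s) z * g (u, s) z ∂(lawUS Q κ).condKernel u) :=
    Measurable.lintegral_kernel_prod_right (κ := (lawUS Q κ).condKernel.comap Prod.fst
      measurable_fst) (f := fun (p : 𝒰 × 𝒵) s => densUSZ Q κ (p.1, s) p.2 * g (p.1, s) p.2)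
      (hhg.comp (f := fun q : (𝒰 × 𝒵) × 𝒮 => ((q.1.1, q.2), q.1.2)) (by fun_prop))
  -- The first density carries `P_U × P_Z` below `P_{UZ}`; attaching `P_{S|U}` gives the reference
  -- law, which the second density carries below `P_{USZ}`.
  refine le_trans ?_ ((lintegral_densUZ_le Q QU hΦ).trans (lintegral_densUSZ_le Q hκ hg))
  rw [lintegral_lawUS_eq Q hκ (Measurable.lintegral_prod_right hfhg)]
  refine lintegral_mono fun u => ?_
  rw [lintegral_lintegral_swap]
  · refine lintegral_mono fun z => ?_
    simp only [mul_assoc]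
    rw [lintegral_const_mul]
    exact hhg.comp (f := fun s : 𝒮 => ((u, s), z)) (by fun_prop)
  · exact (hfhg.comp (f := fun q : 𝒮 × 𝒵 => ((u, q.1), q.2)) (by fun_prop)).aemeasurable

/-- By the Markov chain `(U, S) - Z - X^m`, the observations come from the same conditional law
given `z` on both sides, so the domination extends from `Z` to `X_l`. -/
lemma lintegral_densUZ_mul_densUSZ_source_le [∀ l, StandardBorelSpace (𝒳 l)]
    (hκ : ∀ᵐ z ∂Q.fst, (κ z).fst = QU z) (l : Fin m)
    {g : 𝒰 × 𝒮 → 𝒳 l → ℝ≥0∞} (hg : Measurable (Function.uncurry g)) :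
    ∫⁻ a, ∫⁻ p, densUZ Q QU a.1 p.1 * densUSZ Q κ a p.1 * g a (p.2 l) ∂Q ∂lawUS Q κ ≤
      ∫⁻ w, g w.1 w.2 ∂lawUSX Q κ l := by
  have : Nonempty (∀ l, 𝒳 l) := by
    obtain ⟨p⟩ := nonempty_of_isProbabilityMeasure Q
    exact ⟨p.2⟩
  have hf := (measurable_densUZ Q QU).coe_nnreal_ennreal
  have hh := (measurable_densUSZ Q κ).coe_nnreal_ennreal
  have hfh : Measurable fun q : (𝒰 × 𝒮) × 𝒵 =>
      (densUZ Q QU q.1.1 q.2 : ℝ≥0∞) * densUSZ Q κ q.1 q.2 :=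
    (hf.comp (f := fun q : (𝒰 × 𝒮) × 𝒵 => (q.1.1, q.2)) (by fun_prop)).mul hh
  have hG : Measurable (Function.uncurry fun (a : 𝒰 × 𝒮) (z : 𝒵) =>
      ∫⁻ x, g a (x l) ∂Q.condKernel z) :=
    Measurable.lintegral_kernel_prod_right (κ := Q.condKernel.comap Prod.snd measurable_snd)
      (f := fun (p : (𝒰 × 𝒮) × 𝒵) x => g p.1 (x l))
      (hg.comp (f := fun q : ((𝒰 × 𝒮) × 𝒵) × (∀ l, 𝒳 l) => (q.1.1, q.2 l)) (by fun_prop))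
  have hga : ∀ a, Measurable fun x : ∀ l, 𝒳 l => g a (x l) := fun a =>
    hg.of_uncurry_left.comp (measurable_pi_apply l)
  calc _ = ∫⁻ a, ∫⁻ z, densUZ Q QU a.1 z * densUSZ Q κ a z *
          ∫⁻ x, g a (x l) ∂Q.condKernel z ∂Q.fst ∂lawUS Q κ := by
        refine lintegral_congr fun a => ?_
        have hm : Measurable fun p : 𝒵 × (∀ l, 𝒳 l) =>
            (densUZ Q QU a.1 p.1 : ℝ≥0∞) * densUSZ Q κ a p.1 * g a (p.2 l) :=
          (hfh.comp (f := fun p : 𝒵 × (∀ l, 𝒳 l) => (a, p.1)) (by fun_prop)).mul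
            ((hga a).comp measurable_snd)
        rw [← Measure.lintegral_condKernel hm]
        refine lintegral_congr fun z => ?_
        exact lintegral_const_mul ((densUZ Q QU a.1 z : ℝ≥0∞) * densUSZ Q κ a z) (hga a)
    _ ≤ _ := lintegral_densUZ_mul_densUSZ_le Q hκ hG
    _ = ∫⁻ z, ∫⁻ a, ∫⁻ x, g a (x l) ∂Q.condKernel z ∂κ z ∂Q.fst :=
        lintegral_lawUSZ Q κ (hG.comp (f := fun w : 𝒰 × 𝒮 × 𝒵 => ((w.1, w.2.1), w.2.2))
          (by fun_prop))
    _ = ∫⁻ z, ∫⁻ x, ∫⁻ a, g a (x l) ∂κ z ∂Q.condKernel z ∂Q.fst := by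
        refine lintegral_congr fun z => lintegral_lintegral_swap ?_
        exact (hg.comp (f := fun q : (𝒰 × 𝒮) × (∀ l, 𝒳 l) => (q.1, q.2 l))
          (by fun_prop)).aemeasurable
    _ = ∫⁻ p, ∫⁻ a, g a (p.2 l) ∂κ p.1 ∂Q := by
        refine Measure.lintegral_condKernel (f := fun p : 𝒵 × (∀ l, 𝒳 l) =>
          ∫⁻ a, g a (p.2 l) ∂κ p.1) ?_
        exact Measurable.lintegral_kernel_prod_right (κ := κ.comap Prod.fst measurable_fst)
          (f := fun (p : 𝒵 × (∀ l, 𝒳 l)) a => g a (p.2 l))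
          (hg.comp (f := fun q : (𝒵 × (∀ l, 𝒳 l)) × (𝒰 × 𝒮) => (q.2, q.1.2 l)) (by fun_prop))
    _ = _ := (lintegral_lawUSX Q κ l (g := fun w => g w.1 w.2) hg).symm

end Laws

/-! ### The random codebook -/

set_option linter.unusedSectionVars false

section RandomCodebook

variable {m : ℕ} {𝒵 : Type*} [MeasurableSpace 𝒵] {𝒳 : Fin m → Type*} [∀ l, MeasurableSpace (𝒳 l)]
  {𝒰 : Type*} [MeasurableSpace 𝒰] {𝒮 : Fin m → Type*} [∀ l, MeasurableSpace (𝒮 l)]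
  [∀ l, StandardBorelSpace (𝒮 l)] [∀ l, Nonempty (𝒮 l)]
  (Q : Measure (𝒵 × (∀ l, 𝒳 l))) [IsProbabilityMeasure Q]
  (QU : Kernel 𝒵 𝒰) [IsMarkovKernel QU]
  (QUS : ∀ l, Kernel 𝒵 (𝒰 × 𝒮 l)) [∀ l, IsMarkovKernel (QUS l)]
  (B : Fin m → Type*) [∀ l, Fintype (B l)]

/-- The law of a codeword `u` together with its satellite codewords `s_{l,j}`. -/
def codewordLaw : Measure (𝒰 × ∀ l, B l → 𝒮 l) :=
  (lawUZ Q QU).fst ⊗ₘ piKernel fun l => piKernel fun _ : B l => (lawUS Q (QUS l)).condKernel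

instance isProbabilityMeasure_codewordLaw : IsProbabilityMeasure (codewordLaw Q QU QUS B) := by
  unfold codewordLaw
  infer_instance

lemma lintegral_codewordLaw_center {g : 𝒰 → ℝ≥0∞} (hg : Measurable g) :
    ∫⁻ w, g w.1 ∂codewordLaw Q QU QUS B = ∫⁻ u, g u ∂(lawUZ Q QU).fst := by
  rw [codewordLaw, Measure.lintegral_compProd (by fun_prop)]
  simp

lemma lintegral_codewordLaw_satellites (l : Fin m) {g : 𝒰 → (B l → 𝒮 l) → ℝ≥0∞}
    (hg : Measurable (Function.uncurry g)) :
    ∫⁻ w, g w.1 (w.2 l) ∂codewordLaw Q QU QUS B =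
      ∫⁻ u, ∫⁻ s, g u s ∂Measure.pi (fun _ : B l => (lawUS Q (QUS l)).condKernel u)
        ∂(lawUZ Q QU).fst := by
  have hm : Measurable fun w : 𝒰 × ∀ l, B l → 𝒮 l => g w.1 (w.2 l) :=
    hg.comp (f := fun w : 𝒰 × ∀ l, B l → 𝒮 l => (w.1, w.2 l)) (by fun_prop)
  rw [codewordLaw, Measure.lintegral_compProd hm]
  refine lintegral_congr fun u => ?_
  rw [piKernel_apply]
  exact lintegral_pi_eval (fun l => piKernel (fun _ : B l => (lawUS Q (QUS l)).condKernel) u) l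
    (g := g u) hg.of_uncurry_left

variable {QU QUS} in
lemma measurePreserving_codeword (hQ : ∀ l, ∀ᵐ z ∂Q.fst, (QUS l z).fst = QU z) (l : Fin m)
    (j : B l) :
    MeasurePreserving (fun w : 𝒰 × ∀ l, B l → 𝒮 l => (w.1, w.2 l j)) (codewordLaw Q QU QUS B)
      (lawUS Q (QUS l)) := by
  refine ⟨by fun_prop, Measure.ext_of_lintegral _ fun g hg => ?_⟩
  rw [lintegral_map hg (by fun_prop), lintegral_codewordLaw_satellites Q QU QUS B l
    (g := fun u s => g (u, s j)) (by unfold Function.uncurry; fun_prop),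
    lintegral_lawUS_eq Q (hQ l) hg]
  refine lintegral_congr fun u => ?_
  exact lintegral_pi_eval (fun _ : B l => (lawUS Q (QUS l)).condKernel u) j
    (g := fun s => g (u, s)) (by fun_prop)

variable (α : Type*) [Fintype α]

/-- The law of the random codebook. -/
def codebookLaw : Measure (α → 𝒰 × ∀ l, B l → 𝒮 l) :=
  Measure.pi fun _ : α => codewordLaw Q QU QUS B

instance isProbabilityMeasure_codebookLaw : IsProbabilityMeasure (codebookLaw Q QU QUS B α) := by
  unfold codebookLaw
  infer_instance

variable {B α}

/-- The codeword `(u_i, s_{l,i,j})` of a codebook. -/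
def word (l : Fin m) (c : α → 𝒰 × ∀ l, B l → 𝒮 l) (i : α) (j : B l) : 𝒰 × 𝒮 l :=
  ((c i).1, (c i).2 l j)

variable {QU QUS} in
lemma measurePreserving_word (hQ : ∀ l, ∀ᵐ z ∂Q.fst, (QUS l z).fst = QU z) (l : Fin m) (i : α)
    (j : B l) :
    MeasurePreserving (fun c => word l c i j) (codebookLaw Q QU QUS B α) (lawUS Q (QUS l)) :=
  (measurePreserving_codeword Q B hQ l j).comp
    (measurePreserving_eval (fun _ : α => codewordLaw Q QU QUS B) i)

-- Satellites of distinct centres are independent. Equal `j` is the only case needed, since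
-- competitors share the message and hence `j`.
variable {QU QUS} in
lemma lintegral_word_pair (hQ : ∀ l, ∀ᵐ z ∂Q.fst, (QUS l z).fst = QU z) (l : Fin m) {i i' : α}
    (hi : i ≠ i') (j : B l) {g : 𝒰 × 𝒮 l → 𝒰 × 𝒮 l → ℝ≥0∞}
    (hg : Measurable (Function.uncurry g)) :
    ∫⁻ c, g (word l c i j) (word l c i' j) ∂codebookLaw Q QU QUS B α =
      ∫⁻ a, ∫⁻ a', g a a' ∂lawUS Q (QUS l) ∂lawUS Q (QUS l) := by
  have hp := measurePreserving_codeword Q B hQ l j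
  have hm : Measurable fun q : (𝒰 × ∀ l, B l → 𝒮 l) × (𝒰 × ∀ l, B l → 𝒮 l) =>
      g (q.1.1, q.1.2 l j) (q.2.1, q.2.2 l j) :=
    hg.comp (f := fun q : (𝒰 × ∀ l, B l → 𝒮 l) × (𝒰 × ∀ l, B l → 𝒮 l) =>
      ((q.1.1, q.1.2 l j), (q.2.1, q.2.2 l j))) (by fun_prop)
  refine (lintegral_pi_eval_pair (codewordLaw Q QU QUS B) hi hm).trans ?_
  rw [← hp.lintegral_comp (Measurable.lintegral_prod_right hg)]
  refine lintegral_congr fun w => ?_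
  exact hp.lintegral_comp (f := g (w.1, w.2 l j)) hg.of_uncurry_left

/-! ### Expected covering loss of the random codebook -/

variable [StandardBorelSpace 𝒵] [Nonempty 𝒵]

lemma measurable_coverWeight_word (l : Fin m) :
    Measurable fun q : (α → 𝒰 × ∀ l, B l → 𝒮 l) × 𝒵 =>
      coverWeight (fun i => densUZ Q QU (q.1 i).1)
        (fun i j => densUSZ Q (QUS l) (word l q.1 i j)) q.2 := by
  have hf := fun i : α => measurable_densUZ_comp Q QU
    (φ := fun c : α → 𝒰 × ∀ l, B l → 𝒮 l => (c i).1) (by fun_prop)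
  have hh := fun (i : α) j => measurable_densUSZ_comp Q (QUS l)
    (φ := fun c : α → 𝒰 × ∀ l, B l → 𝒮 l => word l c i j) (by unfold word; fun_prop)
  unfold coverWeight
  fun_prop

lemma lintegral_lintegral_one_sub_center_le [Nonempty α] :
    ∫⁻ c, ∫⁻ z, (1 - (Fintype.card α : ℝ≥0∞)⁻¹ * ∑ i, (densUZ Q QU (c i).1 z : ℝ≥0∞)) ∂Q.fst
      ∂codebookLaw Q QU QUS B α ≤
      ENNReal.ofReal (coveringTerm (lawUZ Q QU) (infoDensity (lawUZ Q QU)) (Fintype.card α)) := by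
  have hf := fun i : α => measurable_densUZ_comp Q QU
    (φ := fun c : α → 𝒰 × ∀ l, B l → 𝒮 l => (c i).1) (by fun_prop)
  rw [lintegral_lintegral_swap]
  · refine lintegral_covering_le (lawUZ Q QU) ((lawUZ Q QU).fst.prod (lawUZ Q QU).snd) Q.fst
      (Kernel.const 𝒵 (codewordLaw Q QU QUS B)) (e := fun z w => (w.1, z))
      (by unfold Function.uncurry; fun_prop) measurable_snd (fun _ _ => rfl) (snd_lawUZ Q QU) ?_
    intro g hg
    rw [lintegral_prod_symm _ hg.aemeasurable, snd_lawUZ]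
    refine lintegral_congr fun z => ?_
    rw [Kernel.const_apply]
    exact (lintegral_codewordLaw_center Q QU QUS B (g := fun u => g (u, z)) (by fun_prop)).symm
  · refine Measurable.aemeasurable ?_
    unfold Function.uncurry
    fun_prop

variable {QU QUS}

/-- For each `i`, averaging over the satellites first leaves a function of `(u_i, z)`. The weight of
the first layer then carries `P_U × P_Z` below `P_{UZ}`, and soft covering given `(u, z)` applies.
The average over `i` costs nothing. -/
lemma lintegral_lintegral_one_sub_satellites_le [Nonempty α] [∀ l, Nonempty (B l)]
    (hQ : ∀ l, ∀ᵐ z ∂Q.fst, (QUS l z).fst = QU z) (l : Fin m) :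
    ∫⁻ c, ∫⁻ z, ∑ i, (Fintype.card α : ℝ≥0∞)⁻¹ * densUZ Q QU (c i).1 z *
        (1 - (Fintype.card (B l) : ℝ≥0∞)⁻¹ *
          ∑ j, (densUSZ Q (QUS l) (word l c i j) z : ℝ≥0∞)) ∂Q.fst ∂codebookLaw Q QU QUS B α ≤
      ENNReal.ofReal (coveringTerm (lawUSZ Q (QUS l)) (condInfoDensity (lawUSZ Q (QUS l)))
        (Fintype.card (B l))) := by
  set n : ℝ≥0∞ := (Fintype.card α : ℝ≥0∞)⁻¹ with hn
  set b : ℝ≥0∞ := (Fintype.card (B l) : ℝ≥0∞)⁻¹ with hb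
  have hf := fun i : α => measurable_densUZ_comp Q QU
    (φ := fun c : α → 𝒰 × ∀ l, B l → 𝒮 l => (c i).1) (by fun_prop)
  have hh := fun (i : α) j => measurable_densUSZ_comp Q (QUS l)
    (φ := fun c : α → 𝒰 × ∀ l, B l → 𝒮 l => word l c i j) (by unfold word; fun_prop)
  have hk : Measurable fun q : (𝒰 × 𝒵) × (B l → 𝒮 l) =>
      1 - b * ∑ j, (densUSZ Q (QUS l) (q.1.1, q.2 j) q.1.2 : ℝ≥0∞) := by
    refine measurable_const.sub (measurable_const.mul (Finset.measurable_sum _ fun j _ => ?_))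
    exact ((measurable_densUSZ Q (QUS l)).comp
      (f := fun q : (𝒰 × 𝒵) × (B l → 𝒮 l) => ((q.1.1, q.2 j), q.1.2))
      (by fun_prop)).coe_nnreal_ennreal
  have hfu := (measurable_densUZ Q QU).coe_nnreal_ennreal
  let Ψ : 𝒰 → 𝒵 → ℝ≥0∞ := fun u z =>
    ∫⁻ s, (1 - b * ∑ j, (densUSZ Q (QUS l) (u, s j) z : ℝ≥0∞))
      ∂Measure.pi (fun _ : B l => (lawUS Q (QUS l)).condKernel u)
  have hΨ : Measurable (Function.uncurry Ψ) :=
    Measurable.lintegral_kernel_prod_right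
      (κ := (piKernel fun _ : B l => (lawUS Q (QUS l)).condKernel).comap Prod.fst measurable_fst)
      (f := fun (p : 𝒰 × 𝒵) s => 1 - b * ∑ j, (densUSZ Q (QUS l) (p.1, s j) p.2 : ℝ≥0∞)) hk
  have hterm : ∀ i : α, ∫⁻ c, ∫⁻ z, densUZ Q QU (c i).1 z *
      (1 - b * ∑ j, (densUSZ Q (QUS l) (word l c i j) z : ℝ≥0∞)) ∂Q.fst
        ∂codebookLaw Q QU QUS B α ≤
      ENNReal.ofReal (coveringTerm (lawUSZ Q (QUS l)) (condInfoDensity (lawUSZ Q (QUS l)))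
        (Fintype.card (B l))) := by
    intro i
    have hg : Measurable fun q : (𝒰 × (B l → 𝒮 l)) × 𝒵 => (densUZ Q QU q.1.1 q.2 : ℝ≥0∞) *
        (1 - b * ∑ j, (densUSZ Q (QUS l) (q.1.1, q.1.2 j) q.2 : ℝ≥0∞)) :=
      (hfu.comp (f := fun q : (𝒰 × (B l → 𝒮 l)) × 𝒵 => (q.1.1, q.2)) (by fun_prop)).mul
        (hk.comp (f := fun q : (𝒰 × (B l → 𝒮 l)) × 𝒵 => ((q.1.1, q.2), q.1.2)) (by fun_prop))
    have hG : Measurable (Function.uncurry fun (u : 𝒰) (s : B l → 𝒮 l) =>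
        ∫⁻ z, densUZ Q QU u z *
          (1 - b * ∑ j, (densUSZ Q (QUS l) (u, s j) z : ℝ≥0∞)) ∂Q.fst) :=
      Measurable.lintegral_prod_right hg
    calc _ = ∫⁻ u, ∫⁻ s, ∫⁻ z, densUZ Q QU u z *
          (1 - b * ∑ j, (densUSZ Q (QUS l) (u, s j) z : ℝ≥0∞)) ∂Q.fst
          ∂Measure.pi (fun _ : B l => (lawUS Q (QUS l)).condKernel u) ∂(lawUZ Q QU).fst := by
          rw [← lintegral_codewordLaw_satellites Q QU QUS B l hG]
          exact lintegral_pi_eval (fun _ : α => codewordLaw Q QU QUS B) i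
            (hG.comp (f := fun w : 𝒰 × ∀ l, B l → 𝒮 l => (w.1, w.2 l)) (by fun_prop))
      _ = ∫⁻ u, ∫⁻ z, densUZ Q QU u z * Ψ u z ∂Q.fst ∂(lawUZ Q QU).fst := by
          refine lintegral_congr fun u => ?_
          rw [lintegral_lintegral_swap]
          · refine lintegral_congr fun z => ?_
            exact lintegral_const_mul (densUZ Q QU u z : ℝ≥0∞)
              (hk.comp (f := fun s : B l → 𝒮 l => ((u, z), s)) (by fun_prop))
          · exact (hg.comp (f := fun q : (B l → 𝒮 l) × 𝒵 => ((u, q.1), q.2))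
              (by fun_prop)).aemeasurable
      _ ≤ ∫⁻ p, Ψ p.1 p.2 ∂lawUZ Q QU := lintegral_densUZ_le Q QU hΨ
      _ ≤ _ := by
          refine lintegral_covering_le (lawUSZ Q (QUS l)) (refLaw Q (QUS l)) (lawUZ Q QU)
            ((lawUS Q (QUS l)).condKernel.comap Prod.fst measurable_fst)
            (e := fun p s => (p.1, s, p.2)) (p := fun w => (w.1, w.2.2))
            (by unfold Function.uncurry; fun_prop) (by fun_prop) (fun _ _ => rfl)
            (map_lawUSZ Q (hQ l)) ?_
          intro g hg
          exact lintegral_refLaw Q (hQ l) hg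
  have hmeas : ∀ i, Measurable (Function.uncurry fun (c : α → 𝒰 × ∀ l, B l → 𝒮 l) (z : 𝒵) =>
      (densUZ Q QU (c i).1 z : ℝ≥0∞) *
        (1 - b * ∑ j, (densUSZ Q (QUS l) (word l c i j) z : ℝ≥0∞))) := by
    intro i
    unfold Function.uncurry
    fun_prop
  calc _ = ∑ i, n * ∫⁻ c, ∫⁻ z, densUZ Q QU (c i).1 z *
      (1 - b * ∑ j, (densUSZ Q (QUS l) (word l c i j) z : ℝ≥0∞)) ∂Q.fst
        ∂codebookLaw Q QU QUS B α := by
        simp only [mul_assoc]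
        have h1 : ∀ c : α → 𝒰 × ∀ l, B l → 𝒮 l, ∫⁻ z, ∑ i, n * ((densUZ Q QU (c i).1 z : ℝ≥0∞) *
            (1 - b * ∑ j, (densUSZ Q (QUS l) (word l c i j) z : ℝ≥0∞))) ∂Q.fst =
            ∑ i, n * ∫⁻ z, densUZ Q QU (c i).1 z *
            (1 - b * ∑ j, (densUSZ Q (QUS l) (word l c i j) z : ℝ≥0∞)) ∂Q.fst := by
          intro c
          have hc := fun i => (hmeas i).of_uncurry_left (x := c)
          rw [lintegral_finsetSum _ fun i _ => (hc i).const_mul n]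
          exact Finset.sum_congr rfl fun i _ => lintegral_const_mul n (hc i)
        have hc := fun i => Measurable.lintegral_prod_right (ν := Q.fst) (hmeas i)
        rw [lintegral_congr h1, lintegral_finsetSum _ fun i _ => (hc i).const_mul n]
        exact Finset.sum_congr rfl fun i _ => lintegral_const_mul n (hc i)
    _ ≤ ∑ _i : α, n * ENNReal.ofReal (coveringTerm (lawUSZ Q (QUS l))
          (condInfoDensity (lawUSZ Q (QUS l))) (Fintype.card (B l))) := by
        gcongr with i
        exact hterm i
    _ = _ := by
        rw [Finset.sum_const, nsmul_eq_mul, ← mul_assoc, Finset.card_univ,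
          ENNReal.mul_inv_cancel (by simp) (ENNReal.natCast_ne_top _), one_mul]

lemma lintegral_lintegral_coverWeight_le [Nonempty α] [∀ l, Nonempty (B l)]
    (hQ : ∀ l, ∀ᵐ z ∂Q.fst, (QUS l z).fst = QU z) (l : Fin m) :
    ∫⁻ c, ∫⁻ z, coverWeight (fun i => densUZ Q QU (c i).1)
        (fun i j => densUSZ Q (QUS l) (word l c i j)) z ∂Q.fst ∂codebookLaw Q QU QUS B α ≤
      ENNReal.ofReal (coveringTerm (lawUZ Q QU) (infoDensity (lawUZ Q QU)) (Fintype.card α)) +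
      ENNReal.ofReal (coveringTerm (lawUSZ Q (QUS l)) (condInfoDensity (lawUSZ Q (QUS l)))
        (Fintype.card (B l))) := by
  have hf := fun i : α => measurable_densUZ_comp Q QU
    (φ := fun c : α → 𝒰 × ∀ l, B l → 𝒮 l => (c i).1) (by fun_prop)
  have hm : Measurable (Function.uncurry fun (c : α → 𝒰 × ∀ l, B l → 𝒮 l) (z : 𝒵) =>
      1 - (Fintype.card α : ℝ≥0∞)⁻¹ * ∑ i, (densUZ Q QU (c i).1 z : ℝ≥0∞)) := by
    unfold Function.uncurry
    fun_prop
  refine le_trans (le_of_eq ?_) (add_le_add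
    (lintegral_lintegral_one_sub_center_le (α := α) (B := B) Q QU QUS)
    (lintegral_lintegral_one_sub_satellites_le (α := α) (B := B) Q hQ l))
  rw [← lintegral_add_left (Measurable.lintegral_prod_right hm)]
  refine lintegral_congr fun c => ?_
  exact lintegral_add_left (hm.of_uncurry_left) _

variable (QU QUS) in
/-- The likelihood ratio used by decoder `l`. -/
def metric (l : Fin m) (a : 𝒰 × 𝒮 l) (x : 𝒳 l) : ℝ≥0∞ :=
  ratio (lawUSX Q (QUS l) l) ((lawUSX Q (QUS l) l).fst.prod (lawUSX Q (QUS l) l).snd) (a, x)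

/-- Domination of the ideal law by the true one, tested on sets of codewords, bounds the ideal mass
of almost every single codeword. Uniformity of the key needs this for every index, not on average,
so it enters the selection as an almost sure condition. -/
lemma ae_lintegral_dens_word_le_one (hQ : ∀ l, ∀ᵐ z ∂Q.fst, (QUS l z).fst = QU z) :
    ∀ᵐ c ∂codebookLaw Q QU QUS B α, ∀ l i j,
      ∫⁻ z, (densUZ Q QU (c i).1 z : ℝ≥0∞) * densUSZ Q (QUS l) (word l c i j) z ∂Q.fst ≤ 1 := by
  refine ae_all_iff.2 fun l => ae_all_iff.2 fun i => ae_all_iff.2 fun j => ?_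
  have hm : Measurable fun q : (𝒰 × 𝒮 l) × 𝒵 =>
      (densUZ Q QU q.1.1 q.2 : ℝ≥0∞) * densUSZ Q (QUS l) q.1 q.2 :=
    (measurable_densUZ_comp Q QU (φ := fun a : 𝒰 × 𝒮 l => a.1) measurable_fst).mul
      (measurable_densUSZ_comp Q (QUS l) measurable_id)
  have h : ∀ᵐ a ∂lawUS Q (QUS l),
      ∫⁻ z, (densUZ Q QU a.1 z : ℝ≥0∞) * densUSZ Q (QUS l) a z ∂Q.fst ≤ 1 := by
    refine ae_le_of_forall_setLIntegral_le_of_sigmaFinite (Measurable.lintegral_prod_right hm)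
      fun s hs _ => ?_
    have hs1 : Measurable (s.indicator (1 : 𝒰 × 𝒮 l → ℝ≥0∞)) := measurable_one.indicator hs
    have h1 := lintegral_densUZ_mul_densUSZ_le Q (hQ l) (g := fun a _ => s.indicator 1 a)
      (hs1.comp measurable_fst)
    rw [← lintegral_indicator hs, ← lintegral_indicator hs]
    refine (le_of_eq (lintegral_congr fun a => ?_)).trans (h1.trans (le_of_eq ?_))
    · have hma : Measurable fun z => (densUZ Q QU a.1 z : ℝ≥0∞) * densUSZ Q (QUS l) a z :=
        hm.comp measurable_prodMk_left
      rw [lintegral_mul_const _ hma]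
      by_cases ha : a ∈ s <;> simp [ha]
    · rw [lawUS, ← lintegral_map hs1 (by fun_prop)]
      rfl
  exact (measurePreserving_word (α := α) Q hQ l i j).quasiMeasurePreserving.ae h

lemma measurable_metric (l : Fin m) : Measurable (Function.uncurry (metric Q QUS l)) :=
  measurable_ratio _ _

lemma measurableSet_confused_word {W : Type*} (l : Fin m) (msg : α → B l → W) (i : α) (j : B l) :
    MeasurableSet {q : (α → 𝒰 × ∀ l, B l → 𝒮 l) × 𝒳 l |
      q.2 ∈ Confused msg (fun i j => metric Q QUS l (word l q.1 i j)) i j} :=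
  measurableSet_confused msg (r := fun i j (q : (α → 𝒰 × ∀ l, B l → 𝒮 l) × 𝒳 l) =>
      metric Q QUS l (word l q.1 i j) q.2)
    (fun i j => (measurable_metric Q l).comp
      (f := fun q : (α → 𝒰 × ∀ l, B l → 𝒮 l) × 𝒳 l => (word l q.1 i j, q.2))
      (by unfold word; fun_prop)) i j

/-! ### Expected decoding loss of the random codebook -/

variable [∀ l, StandardBorelSpace (𝒳 l)]

-- Fix a threshold `τ`. Confusion means that the metric of the ideal codeword is at most `τ`, or
-- that some competitor's exceeds `τ`. The first event is charged to the true law of `((U, S_l),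
-- X_l)`, the second to the product of its marginals once per competitor. The threshold occurs only
-- in this analysis.
set_option maxHeartbeats 1000000 in
lemma lintegral_lintegral_confused_le {W : Type*} [DecidableEq α] [DecidableEq W]
    (hQ : ∀ l, ∀ᵐ z ∂Q.fst, (QUS l z).fst = QU z) (l : Fin m) (msg : α → B l → W) (i : α) (j : B l)
    {M : ℕ} (hM : ({i' | i' ≠ i ∧ msg i' j = msg i j} : Finset α).card ≤ M - 1) :
    ∫⁻ c, ∫⁻ p, densUZ Q QU (c i).1 p.1 * densUSZ Q (QUS l) (word l c i j) p.1 *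
        (Confused msg (fun i j => metric Q QUS l (word l c i j)) i j).indicator 1 (p.2 l) ∂Q
        ∂codebookLaw Q QU QUS B α ≤
      ENNReal.ofReal (decodingTerm (lawUSX Q (QUS l) l) (infoDensity (lawUSX Q (QUS l) l)) M) := by
  refine decoding_le _ M fun τ => ?_
  set P := lawUSX Q (QUS l) l with hP
  set S : Finset α := {i' | i' ≠ i ∧ msg i' j = msg i j} with hS
  have hr := measurable_ratio P (P.fst.prod P.snd)
  have hA : MeasurableSet {w | ratio P (P.fst.prod P.snd) w ≤ τ} :=
    measurableSet_le hr measurable_const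
  have hA' : MeasurableSet {w | τ < ratio P (P.fst.prod P.snd) w} :=
    measurableSet_lt measurable_const hr
  set A := {w | ratio P (P.fst.prod P.snd) w ≤ τ}
  set A' := {w | τ < ratio P (P.fst.prod P.snd) w}
  have hG1 : Measurable (Function.uncurry fun (a : 𝒰 × 𝒮 l) (x : 𝒳 l) =>
      A.indicator (1 : (𝒰 × 𝒮 l) × 𝒳 l → ℝ≥0∞) (a, x)) := measurable_one.indicator hA
  have hG2 : Measurable (Function.uncurry fun (a : 𝒰 × 𝒮 l) (x : 𝒳 l) =>
      A'.indicator (1 : (𝒰 × 𝒮 l) × 𝒳 l → ℝ≥0∞) (a, x)) := measurable_one.indicator hA'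
  have hwt : Measurable fun q : (𝒰 × 𝒮 l) × 𝒵 =>
      (densUZ Q QU q.1.1 q.2 : ℝ≥0∞) * densUSZ Q (QUS l) q.1 q.2 :=
    (measurable_densUZ_comp Q QU (φ := fun a : 𝒰 × 𝒮 l => a.1) measurable_fst).mul
      (measurable_densUSZ_comp Q (QUS l) measurable_id)
  let F1 : 𝒰 × 𝒮 l → ℝ≥0∞ := fun a => ∫⁻ p, densUZ Q QU a.1 p.1 * densUSZ Q (QUS l) a p.1 *
    A.indicator 1 (a, p.2 l) ∂Q
  let F2 : 𝒰 × 𝒮 l → 𝒰 × 𝒮 l → ℝ≥0∞ := fun a a' => ∫⁻ p, densUZ Q QU a.1 p.1 *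
    densUSZ Q (QUS l) a p.1 * A'.indicator 1 (a', p.2 l) ∂Q
  have hf1 : Measurable fun q : (𝒰 × 𝒮 l) × (𝒵 × ∀ l, 𝒳 l) =>
      (densUZ Q QU q.1.1 q.2.1 : ℝ≥0∞) * densUSZ Q (QUS l) q.1 q.2.1 *
        A.indicator 1 (q.1, q.2.2 l) :=
    (hwt.comp (f := fun q : (𝒰 × 𝒮 l) × (𝒵 × ∀ l, 𝒳 l) => (q.1, q.2.1)) (by fun_prop)).mul
      (hG1.comp (f := fun q : (𝒰 × 𝒮 l) × (𝒵 × ∀ l, 𝒳 l) => (q.1, q.2.2 l)) (by fun_prop))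
  have hf2 : Measurable fun q : ((𝒰 × 𝒮 l) × (𝒰 × 𝒮 l)) × (𝒵 × ∀ l, 𝒳 l) =>
      (densUZ Q QU q.1.1.1 q.2.1 : ℝ≥0∞) * densUSZ Q (QUS l) q.1.1 q.2.1 *
        A'.indicator 1 (q.1.2, q.2.2 l) :=
    (hwt.comp (f := fun q : ((𝒰 × 𝒮 l) × (𝒰 × 𝒮 l)) × (𝒵 × ∀ l, 𝒳 l) => (q.1.1, q.2.1))
      (by fun_prop)).mul
      (hG2.comp (f := fun q : ((𝒰 × 𝒮 l) × (𝒰 × 𝒮 l)) × (𝒵 × ∀ l, 𝒳 l) => (q.1.2, q.2.2 l))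
      (by fun_prop))
  have hF1 : Measurable F1 := Measurable.lintegral_prod_right hf1
  have hF2 : Measurable (Function.uncurry F2) := Measurable.lintegral_prod_right hf2
  have hword : ∀ i, Measurable fun c : α → 𝒰 × ∀ l, B l → 𝒮 l => word l c i j := by
    intro i
    unfold word
    fun_prop
  have hpoint : ∀ c : α → 𝒰 × ∀ l, B l → 𝒮 l,
      ∫⁻ p, densUZ Q QU (c i).1 p.1 * densUSZ Q (QUS l) (word l c i j) p.1 *
        (Confused msg (fun i j => metric Q QUS l (word l c i j)) i j).indicator 1 (p.2 l) ∂Q ≤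
      F1 (word l c i j) + ∑ i' ∈ S, F2 (word l c i j) (word l c i' j) := by
    intro c
    have hm1 : Measurable fun p : 𝒵 × ∀ l, 𝒳 l => (densUZ Q QU (c i).1 p.1 : ℝ≥0∞) *
        densUSZ Q (QUS l) (word l c i j) p.1 * A.indicator 1 (word l c i j, p.2 l) :=
      hf1.comp (f := fun p : 𝒵 × ∀ l, 𝒳 l => (word l c i j, p)) measurable_prodMk_left
    have hm2 : ∀ i', Measurable fun p : 𝒵 × ∀ l, 𝒳 l => (densUZ Q QU (c i).1 p.1 : ℝ≥0∞) *
        densUSZ Q (QUS l) (word l c i j) p.1 * A'.indicator 1 (word l c i' j, p.2 l) :=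
      fun i' => hf2.comp
        (f := fun p : 𝒵 × ∀ l, 𝒳 l => ((word l c i j, word l c i' j), p)) measurable_prodMk_left
    calc _ ≤ ∫⁻ p, (densUZ Q QU (c i).1 p.1 * densUSZ Q (QUS l) (word l c i j) p.1 *
          A.indicator 1 (word l c i j, p.2 l) + ∑ i' ∈ S, (densUZ Q QU (c i).1 p.1 : ℝ≥0∞) *
            densUSZ Q (QUS l) (word l c i j) p.1 * A'.indicator 1 (word l c i' j, p.2 l)) ∂Q := by
          refine lintegral_mono fun p => ?_
          rw [← Finset.mul_sum, ← mul_add]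
          gcongr
          by_cases hc : p.2 l ∈ Confused msg (fun i j => metric Q QUS l (word l c i j)) i j
          · rw [Set.indicator_of_mem hc]
            obtain ⟨i', hi', hmsg, hle⟩ := hc
            by_cases hτ : (word l c i j, p.2 l) ∈ A
            · rw [Set.indicator_of_mem hτ]
              exact le_self_add
            · have hlt : τ < ratio P (P.fst.prod P.snd) (word l c i j, p.2 l) := not_le.1 hτ
              have hmem : (word l c i' j, p.2 l) ∈ A' := lt_of_lt_of_le hlt hle
              refine le_trans (le_of_eq ?_) ((Finset.single_le_sum
                (f := fun i' => A'.indicator (1 : (𝒰 × 𝒮 l) × 𝒳 l → ℝ≥0∞) (word l c i' j, p.2 l))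
                (fun _ _ => zero_le) (show i' ∈ S by simp [hS, hi', hmsg])).trans le_add_self)
              simp only [Set.indicator_of_mem hmem, Pi.one_apply]
          · rw [Set.indicator_of_notMem hc]
            exact zero_le
      _ = _ := by
          refine (lintegral_add_left hm1 _).trans ?_
          rw [lintegral_finsetSum S fun i' _ => hm2 i']
          rfl
  have hfirst : ∫⁻ c, F1 (word l c i j) ∂codebookLaw Q QU QUS B α ≤ P A := by
    rw [(measurePreserving_word (α := α) Q hQ l i j).lintegral_comp hF1,
      ← lintegral_indicator_one hA]
    exact lintegral_densUZ_mul_densUSZ_source_le Q (hQ l) l hG1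
  have hsecond : ∀ i' ∈ S, ∫⁻ c, F2 (word l c i j) (word l c i' j) ∂codebookLaw Q QU QUS B α ≤
      (P.fst.prod P.snd) A' := by
    intro i' hi'
    have hne : i ≠ i' := fun h => by simp [hS, h] at hi'
    -- With the competitor fixed outside, the event depends only on `x`, so integrating the ideal
    -- codeword leaves at most the marginal of `X_l`.
    rw [lintegral_word_pair Q hQ l hne j hF2, lintegral_lintegral_swap hF2.aemeasurable,
      ← lintegral_indicator_one hA', lintegral_prod _ (measurable_one.indicator hA').aemeasurable,
      hP, fst_lawUSX]
    refine lintegral_mono fun a' => ?_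
    have hGa : Measurable fun x : 𝒳 l => A'.indicator (1 : (𝒰 × 𝒮 l) × 𝒳 l → ℝ≥0∞) (a', x) :=
      hG2.of_uncurry_left
    refine (lintegral_densUZ_mul_densUSZ_source_le Q (hQ l) l
      (g := fun _ x => A'.indicator 1 (a', x)) (hGa.comp measurable_snd)).trans (le_of_eq ?_)
    rw [Measure.snd, lintegral_map hGa measurable_snd]
  refine (lintegral_mono hpoint).trans ?_
  have hm1 : Measurable fun c : α → 𝒰 × ∀ l, B l → 𝒮 l => F1 (word l c i j) := hF1.comp (hword i)
  have hm2 : ∀ i', Measurable fun c : α → 𝒰 × ∀ l, B l → 𝒮 l =>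
      F2 (word l c i j) (word l c i' j) := fun i' => hF2.comp ((hword i).prodMk (hword i'))
  rw [lintegral_add_left hm1, lintegral_finsetSum S fun i' _ => hm2 i']
  refine add_le_add hfirst ((Finset.sum_le_sum hsecond).trans ?_)
  rw [Finset.sum_const, nsmul_eq_mul]
  gcongr

variable (QU QUS) in
/-- The average decoding loss of a codebook at terminal `l`. -/
def decodeLoss {W : Type*} (l : Fin m) (msg : α → B l → W) (c : α → 𝒰 × ∀ l, B l → 𝒮 l) : ℝ≥0∞ :=
  ∫⁻ p, ∑ i, ∑ j, idealWeight (fun i => densUZ Q QU (c i).1)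
    (fun i j => densUSZ Q (QUS l) (word l c i j)) i j p.1 *
      (Confused msg (fun i j => metric Q QUS l (word l c i j)) i j).indicator 1 (p.2 l) ∂Q

variable (QU QUS) in
/-- The contribution of the codeword `(i, j)` to the decoding loss. -/
def decodeIntegrand {W : Type*} (l : Fin m) (msg : α → B l → W) (i : α) (j : B l)
    (c : α → 𝒰 × ∀ l, B l → 𝒮 l) (p : 𝒵 × ∀ l, 𝒳 l) : ℝ≥0∞ :=
  densUZ Q QU (c i).1 p.1 * densUSZ Q (QUS l) (word l c i j) p.1 *
    (Confused msg (fun i j => metric Q QUS l (word l c i j)) i j).indicator 1 (p.2 l)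

lemma measurable_decodeIntegrand {W : Type*} (l : Fin m) (msg : α → B l → W) (i : α) (j : B l) :
    Measurable (Function.uncurry (decodeIntegrand Q QU QUS l msg i j)) := by
  have hf := measurable_densUZ_comp Q QU
    (φ := fun c : α → 𝒰 × ∀ l, B l → 𝒮 l => (c i).1) (by fun_prop)
  have hh := measurable_densUSZ_comp Q (QUS l)
    (φ := fun c : α → 𝒰 × ∀ l, B l → 𝒮 l => word l c i j) (by unfold word; fun_prop)
  refine ((hf.mul hh).comp (f := fun q : (α → 𝒰 × ∀ l, B l → 𝒮 l) × (𝒵 × ∀ l, 𝒳 l) =>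
    (q.1, q.2.1)) (by fun_prop)).mul ?_
  exact (measurable_one.indicator (measurableSet_confused_word Q l msg i j)).comp
    (f := fun q : (α → 𝒰 × ∀ l, B l → 𝒮 l) × (𝒵 × ∀ l, 𝒳 l) => (q.1, q.2.2 l)) (by fun_prop)

lemma decodeLoss_eq {W : Type*} (l : Fin m) (msg : α → B l → W)
    (c : α → 𝒰 × ∀ l, B l → 𝒮 l) :
    decodeLoss Q QU QUS l msg c = ∑ i, ∑ j, (Fintype.card α : ℝ≥0∞)⁻¹ *
      (Fintype.card (B l) : ℝ≥0∞)⁻¹ * ∫⁻ p, decodeIntegrand Q QU QUS l msg i j c p ∂Q := by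
  have hm := fun i j => (measurable_decodeIntegrand Q (QU := QU) (QUS := QUS) l msg i
    j).of_uncurry_left (x := c)
  have h : ∀ p, ∑ i, ∑ j, idealWeight (fun i => densUZ Q QU (c i).1)
      (fun i j => densUSZ Q (QUS l) (word l c i j)) i j p.1 *
      (Confused msg (fun i j => metric Q QUS l (word l c i j)) i j).indicator 1 (p.2 l) =
      ∑ i, ∑ j, (Fintype.card α : ℝ≥0∞)⁻¹ * (Fintype.card (B l) : ℝ≥0∞)⁻¹ *
        decodeIntegrand Q QU QUS l msg i j c p := fun p =>
    Finset.sum_congr rfl fun i _ => Finset.sum_congr rfl fun j _ => mul_assoc _ _ _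
  rw [decodeLoss, lintegral_congr h, lintegral_finsetSum _ fun i _ =>
    Finset.measurable_sum _ fun j _ => (hm i j).const_mul _]
  refine Finset.sum_congr rfl fun i _ => ?_
  rw [lintegral_finsetSum _ fun j _ => (hm i j).const_mul _]
  exact Finset.sum_congr rfl fun j _ => lintegral_const_mul _ (hm i j)

lemma measurable_decodeLoss {W : Type*} (l : Fin m) (msg : α → B l → W) :
    Measurable (decodeLoss Q QU QUS l msg) := by
  rw [funext fun c => decodeLoss_eq Q (QU := QU) (QUS := QUS) l msg c]
  exact Finset.measurable_sum _ fun i _ => Finset.measurable_sum _ fun j _ =>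
    (Measurable.lintegral_prod_right (measurable_decodeIntegrand Q l msg i j)).const_mul _

lemma lintegral_decodeLoss_le {W : Type*} [DecidableEq α] [DecidableEq W] [Nonempty α]
    [∀ l, Nonempty (B l)]
    (hQ : ∀ l, ∀ᵐ z ∂Q.fst, (QUS l z).fst = QU z) (l : Fin m) (msg : α → B l → W)
    {M : ℕ} (hM : ∀ i j, ({i' | i' ≠ i ∧ msg i' j = msg i j} : Finset α).card ≤ M - 1) :
    ∫⁻ c, decodeLoss Q QU QUS l msg c ∂codebookLaw Q QU QUS B α ≤
      ENNReal.ofReal (decodingTerm (lawUSX Q (QUS l) l) (infoDensity (lawUSX Q (QUS l) l)) M) := by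
  have hm := fun i j => Measurable.lintegral_prod_right (ν := Q)
    (measurable_decodeIntegrand Q (QU := QU) (QUS := QUS) l msg i j)
  rw [lintegral_congr fun c => decodeLoss_eq Q (QU := QU) (QUS := QUS) l msg c,
    lintegral_finsetSum _ fun i _ => Finset.measurable_sum _ fun j _ => (hm i j).const_mul _]
  set x := ENNReal.ofReal
    (decodingTerm (lawUSX Q (QUS l) l) (infoDensity (lawUSX Q (QUS l) l)) M) with hx
  calc _ ≤ ∑ _i : α, ∑ _j : B l, (Fintype.card α : ℝ≥0∞)⁻¹ *
        (Fintype.card (B l) : ℝ≥0∞)⁻¹ * x := by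
        refine Finset.sum_le_sum fun i _ => ?_
        rw [lintegral_finsetSum _ fun j _ => (hm i j).const_mul _]
        refine Finset.sum_le_sum fun j _ => ?_
        rw [lintegral_const_mul _ (hm i j)]
        gcongr
        exact lintegral_lintegral_confused_le Q hQ l msg i j (hM i j)
    _ = ((Fintype.card α : ℝ≥0∞) * (Fintype.card α : ℝ≥0∞)⁻¹) *
        ((Fintype.card (B l) : ℝ≥0∞) * (Fintype.card (B l) : ℝ≥0∞)⁻¹) * x := by
        simp only [Finset.sum_const, nsmul_eq_mul, Finset.card_univ]
        ring
    _ = x := by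
        rw [ENNReal.mul_inv_cancel (by simp) (ENNReal.natCast_ne_top _),
          ENNReal.mul_inv_cancel (by simp) (ENNReal.natCast_ne_top _), one_mul, one_mul]

end RandomCodebook

/-! ### The layered index set -/

section Index

variable {m : ℕ} (I : Fin (m + 1) → ℕ) (l : Fin m)

/-- The indices revealed by the message of terminal `l`. -/
abbrev Revealed : Type := ∀ k : {k : Fin m // k ∈ Finset.Iic l}, Fin (I k.1.succ)

/-- The indices of terminal `l` that are neither revealed nor part of the key. -/
abbrev Hidden : Type := ∀ k : {k : Fin m // k ∉ Finset.Iic l}, Fin (I k.1.succ)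

/-- Splitting an index into the key, the revealed part and the hidden part. -/
def indexEquiv : (∀ i, Fin (I i)) ≃ Fin (I 0) × Revealed I l × Hidden I l :=
  (Fin.consEquiv fun i => Fin (I i)).symm.trans
    ((Equiv.refl _).prodCongr (Equiv.piEquivPiSubtypeProd (fun k => k ∈ Finset.Iic l) _))

lemma card_revealed : Fintype.card (Revealed I l) = ∏ k ∈ Finset.Iic l, I k.succ := by
  simp only [Fintype.card_pi, Fintype.card_fin]
  exact (Finset.prod_subtype (Finset.Iic l) (fun _ => Iff.rfl) fun k => I k.succ).symm

lemma card_hidden : Fintype.card (Hidden I l) = ∏ k ∈ Finset.Ioi l, I k.succ := by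
  simp only [Fintype.card_pi, Fintype.card_fin]
  exact (Finset.prod_subtype (Finset.Ioi l) (fun k => by simp) fun k => I k.succ).symm

variable (J : Fin m → ℕ)

/-- The numbering of the messages of terminal `l`. -/
def messageEquiv :
    Revealed I l × Fin (J l) ≃ Fin ((∏ i ∈ Finset.Iic l, I i.succ) * J l) :=
  Fintype.equivFinOfCardEq (by rw [Fintype.card_prod, card_revealed, Fintype.card_fin])

/-- The message of terminal `l`. -/
def message (i : ∀ i, Fin (I i)) (j : Fin (J l)) : Fin ((∏ i ∈ Finset.Iic l, I i.succ) * J l) :=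
  messageEquiv I l J ((indexEquiv I l i).2.1, j)

lemma message_eq_iff {i i' : ∀ i, Fin (I i)} {j j' : Fin (J l)} :
    message I l J i j = message I l J i' j' ↔
      (indexEquiv I l i).2.1 = (indexEquiv I l i').2.1 ∧ j = j' := by
  simp [message]

/-- The key and the message fix everything except the hidden coordinates, which remain free. -/
lemma card_fiber (k : Fin (I 0)) (w : Fin ((∏ i ∈ Finset.Iic l, I i.succ) * J l)) :
    ({p : (∀ i, Fin (I i)) × Fin (J l) | p.1 0 = k ∧ message I l J p.1 p.2 = w} :
      Finset _).card = Fintype.card (Hidden I l) := by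
  symm
  refine Finset.card_bij (fun (h : Hidden I l) _ =>
    ((indexEquiv I l).symm (k, ((messageEquiv I l J).symm w).1, h),
      ((messageEquiv I l J).symm w).2)) ?_ ?_ ?_
  · intro h _
    rw [Finset.mem_filter_univ]
    refine ⟨?_, ?_⟩
    · exact congrArg Prod.fst ((indexEquiv I l).apply_symm_apply _)
    · simp [message]
  · intro h _ h' _ heq
    simpa using heq
  · rintro ⟨i, j⟩ hp
    rw [Finset.mem_filter_univ] at hp
    refine ⟨(indexEquiv I l i).2.2, Finset.mem_univ _, ?_⟩
    obtain ⟨h1, h2⟩ := hp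
    have h3 : (messageEquiv I l J).symm w = ((indexEquiv I l i).2.1, j) := by
      rw [← h2]
      simp [message]
    refine Prod.ext ((indexEquiv I l).symm_apply_eq.2 ?_) (by rw [h3])
    rw [h3, ← h1]
    rfl

lemma card_index_eq :
    Fintype.card (Hidden I l) * (Fintype.card (Fin (I 0)) *
      Fintype.card (Fin ((∏ i ∈ Finset.Iic l, I i.succ) * J l))) =
      Fintype.card (∀ i, Fin (I i)) * Fintype.card (Fin (J l)) := by
  rw [Fintype.card_congr (indexEquiv I l), Fintype.card_prod, Fintype.card_prod, card_revealed,
    Fintype.card_fin ((∏ i ∈ Finset.Iic l, I i.succ) * J l), Fintype.card_fin (J l)]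
  ring

/-- Competitors share the revealed coordinates, so key and hidden part identify them; the `- 1`
removes `i` itself. -/
lemma card_confusable_le (i : ∀ i, Fin (I i)) (j : Fin (J l)) :
    ({i' | i' ≠ i ∧ message I l J i' j = message I l J i j} : Finset (∀ i, Fin (I i))).card ≤
      I 0 * ∏ i ∈ Finset.Ioi l, I i.succ - 1 := by
  have hcard : Fintype.card (Fin (I 0) × Hidden I l) = I 0 * ∏ i ∈ Finset.Ioi l, I i.succ := by
    rw [Fintype.card_prod, card_hidden, Fintype.card_fin]
  rw [← hcard, ← Finset.card_univ, ← Finset.card_erase_of_mem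
    (Finset.mem_univ ((indexEquiv I l i).1, (indexEquiv I l i).2.2))]
  refine Finset.card_le_card_of_injOn
    (fun i' => ((indexEquiv I l i').1, (indexEquiv I l i').2.2)) ?_ ?_
  · intro i' hi'
    simp only [Finset.coe_filter, Finset.mem_univ, true_and, Set.mem_ofPred_eq,
      message_eq_iff] at hi'
    rw [Finset.mem_coe, Finset.mem_erase]
    refine ⟨fun h => hi'.1 ((indexEquiv I l).injective ?_), Finset.mem_univ _⟩
    rw [Prod.mk.injEq] at h
    exact Prod.ext h.1 (Prod.ext hi'.2.1 h.2)
  · intro a ha b hb h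
    simp only [Finset.coe_filter, Finset.mem_univ, true_and, Set.mem_ofPred_eq,
      message_eq_iff] at ha hb
    rw [Prod.mk.injEq] at h
    exact (indexEquiv I l).injective
      (Prod.ext h.1 (Prod.ext (ha.2.1.trans hb.2.1.symm) h.2))

end Index

/-! ### Selection of one codebook and the final bounds -/

lemma decodingTerm_le_quantEps {m : ℕ} {𝒵 : Type*} [MeasurableSpace 𝒵] {𝒳 : Fin m → Type*}
    [∀ l, MeasurableSpace (𝒳 l)] {𝒰 : Type*} [MeasurableSpace 𝒰] {𝒮 : Fin m → Type*}
    [∀ l, MeasurableSpace (𝒮 l)] (Q : Measure (𝒵 × (∀ l, 𝒳 l)))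
    (QUS : ∀ l, Kernel 𝒵 (𝒰 × 𝒮 l)) (I : Fin (m + 1) → ℕ) (l : Fin m) :
    decodingTerm (lawUSX Q (QUS l) l) (infoDensity (lawUSX Q (QUS l) l))
      (I 0 * ∏ i ∈ Finset.Ioi l, I i.succ) ≤ quantEps Q QUS I :=
  le_ciSup (f := fun l : Fin m => decodingTerm (lawUSX Q (QUS l) l)
    (infoDensity (lawUSX Q (QUS l) l)) (I 0 * ∏ i ∈ Finset.Ioi l, I i.succ))
    (Set.finite_range _).bddAbove l

lemma decodingTerm_nonneg {Ω : Type*} [MeasurableSpace Ω] (P : Measure Ω) (i : Ω → EReal) (M : ℕ) :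
    0 ≤ decodingTerm P i M :=
  Real.iInf_nonneg fun _ => add_nonneg measureReal_nonneg (Real.exp_pos _).le

/-- From the excess over the uniform law to the secrecy gap. -/
lemma secrecyGap_le {κ ω : Type*} [Fintype κ] [Fintype ω] [MeasurableSpace κ] [MeasurableSpace ω]
    [MeasurableSingletonClass κ] [MeasurableSingletonClass ω] (P : Measure (κ × ω))
    [IsProbabilityMeasure P] {x : ℝ} (hx : 0 ≤ x) (hN : 1 ≤ Fintype.card κ * Fintype.card ω)
    (h : ∑ p, (P {p} - ((Fintype.card κ * Fintype.card ω : ℕ) : ℝ≥0∞)⁻¹) ≤ ENNReal.ofReal x) :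
    Real.log (Fintype.card κ) - condEntropy P ≤
      (1 + Real.log (Fintype.card κ * Fintype.card ω : ℕ)) * x := by
  have hN' : (1 : ℝ) ≤ (Fintype.card κ * Fintype.card ω : ℕ) := by exact_mod_cast hN
  refine (log_card_sub_condEntropy_le P).trans ?_
  rw [Nat.cast_mul]
  rw [Nat.cast_mul] at hN'
  refine mul_le_mul_of_nonneg_left ?_ (by linarith [Real.log_nonneg hN'])
  rw [← ENNReal.ofReal_le_ofReal_iff hx, ENNReal.ofReal_sum_of_nonneg fun _ _ => le_max_right _ _]
  refine le_trans (le_of_eq (Finset.sum_congr rfl fun p _ => ?_)) h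
  rw [ENNReal.ofReal_max, ENNReal.ofReal_zero, max_eq_left zero_le,
    ENNReal.ofReal_sub _ (by positivity), ofReal_measureReal, one_div,
    ENNReal.ofReal_inv_of_pos (by linarith), ← Nat.cast_mul, ENNReal.ofReal_natCast]

/-- A random codebook indexed by `α` with satellites indexed by `B l` yields a scheme. -/
theorem exists_scheme {m : ℕ} {𝒵 : Type*} [MeasurableSpace 𝒵] [StandardBorelSpace 𝒵] [Nonempty 𝒵]
    {𝒳 : Fin m → Type*} [∀ l, MeasurableSpace (𝒳 l)] [∀ l, StandardBorelSpace (𝒳 l)]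
    {𝒰 : Type*} [MeasurableSpace 𝒰]
    {𝒮 : Fin m → Type*} [∀ l, MeasurableSpace (𝒮 l)] [∀ l, StandardBorelSpace (𝒮 l)]
    [∀ l, Nonempty (𝒮 l)]
    (Q : Measure (𝒵 × (∀ l, 𝒳 l))) [IsProbabilityMeasure Q]
    (QU : Kernel 𝒵 𝒰) [IsMarkovKernel QU]
    (QUS : ∀ l, Kernel 𝒵 (𝒰 × 𝒮 l)) [∀ l, IsMarkovKernel (QUS l)]
    (hQ : ∀ l, ∀ᵐ z ∂Q.fst, (QUS l z).fst = QU z)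
    {α K : Type*} {B W : Fin m → Type*} [Fintype α] [Nonempty α] [DecidableEq α]
    [MeasurableSpace α] [MeasurableSingletonClass α]
    [∀ l, Fintype (B l)] [∀ l, Nonempty (B l)] [∀ l, MeasurableSpace (B l)]
    [∀ l, MeasurableSingletonClass (B l)]
    [Fintype K] [DecidableEq K] [MeasurableSpace K] [MeasurableSingletonClass K]
    [∀ l, Fintype (W l)] [∀ l, DecidableEq (W l)] [∀ l, MeasurableSpace (W l)]
    [∀ l, MeasurableSingletonClass (W l)]
    (key : α → K) (msg : ∀ l, α → B l → W l)
    (hmsg : ∀ l i i' j j', msg l i j = msg l i' j' → j = j')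
    (hfib : ∀ l k w, ({p : α × B l | key p.1 = k ∧ msg l p.1 p.2 = w} : Finset _).card *
      (Fintype.card K * Fintype.card (W l)) = Fintype.card α * Fintype.card (B l))
    {M : Fin m → ℕ}
    (hM : ∀ l i j, ({i' | i' ≠ i ∧ msg l i' j = msg l i j} : Finset α).card ≤ M l - 1) :
    ∃ C : KeyScheme 𝒵 𝒳 K W, ∀ l,
      C.errorProb Q l ≤ 2 * m * (
        decodingTerm (lawUSX Q (QUS l) l) (infoDensity (lawUSX Q (QUS l) l)) (M l) +
        coveringTerm (lawUZ Q QU) (infoDensity (lawUZ Q QU)) (Fintype.card α) +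
        coveringTerm (lawUSZ Q (QUS l)) (condInfoDensity (lawUSZ Q (QUS l)))
          (Fintype.card (B l))) ∧
      IsProbabilityMeasure (C.lawKW Q l) ∧
      ∑ p : K × W l, (C.lawKW Q l {p} - ((Fintype.card K * Fintype.card (W l) : ℕ) : ℝ≥0∞)⁻¹) ≤
        ENNReal.ofReal (2 * m * (
          coveringTerm (lawUZ Q QU) (infoDensity (lawUZ Q QU)) (Fintype.card α) +
          coveringTerm (lawUSZ Q (QUS l)) (condInfoDensity (lawUSZ Q (QUS l)))
            (Fintype.card (B l)))) := by
  set T := coveringTerm (lawUZ Q QU) (infoDensity (lawUZ Q QU)) (Fintype.card α)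
  set Tl : Fin m → ℝ := fun l => coveringTerm (lawUSZ Q (QUS l))
    (condInfoDensity (lawUSZ Q (QUS l))) (Fintype.card (B l)) with hTl_def
  set ε : Fin m → ℝ := fun l =>
    decodingTerm (lawUSX Q (QUS l) l) (infoDensity (lawUSX Q (QUS l) l)) (M l) with hε_def
  have hT : 0 ≤ T := coveringTerm_nonneg _ _ _
  have hTl : ∀ l, 0 ≤ Tl l := fun l => coveringTerm_nonneg _ _ _
  have hε : ∀ l, 0 ≤ ε l := fun l => decodingTerm_nonneg _ _ _
  let cover : Fin m → (α → 𝒰 × ∀ l, B l → 𝒮 l) → ℝ≥0∞ := fun l c =>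
    ∫⁻ z, coverWeight (fun i => densUZ Q QU (c i).1)
      (fun i j => densUSZ Q (QUS l) (word l c i j)) z ∂Q.fst
  have hcoverm : ∀ l, Measurable (cover l) := fun l =>
    Measurable.lintegral_prod_right (measurable_coverWeight_word Q QU QUS l)
  have hcover : ∀ l, ∫⁻ c, cover l c ∂codebookLaw Q QU QUS B α ≤ ENNReal.ofReal (T + Tl l) := by
    intro l
    rw [ENNReal.ofReal_add hT (hTl l)]
    exact lintegral_lintegral_coverWeight_le Q hQ l
  have hdecode : ∀ l, ∫⁻ c, decodeLoss Q QU QUS l (msg l) c ∂codebookLaw Q QU QUS B α ≤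
      ENNReal.ofReal (ε l) := fun l => lintegral_decodeLoss_le Q hQ l (msg l) (hM l)
  -- The index type `Fin m ⊕ Fin m` carries the `m` error losses (covering plus decoding) and the
  -- `m` secrecy losses (covering alone), whence the factor `2 * m`.
  obtain ⟨c, hc, hsel⟩ := exists_le_mul_of_lintegral_le (codebookLaw Q QU QUS B α)
    (φ := Sum.elim (fun l c => cover l c + decodeLoss Q QU QUS l (msg l) c) cover)
    (a := Sum.elim (fun l => ENNReal.ofReal (T + Tl l) + ENNReal.ofReal (ε l))
      (fun l => ENNReal.ofReal (T + Tl l)))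
    (by
      rintro (l | l)
      · exact (hcoverm l).add (measurable_decodeLoss Q l (msg l))
      · exact hcoverm l)
    (by rintro (l | l) <;> simp)
    (by
      rintro (l | l)
      · simp only [Sum.elim_inl]
        rw [lintegral_add_left (hcoverm l)]
        exact add_le_add (hcover l) (hdecode l)
      · exact hcover l)
    (ae_lintegral_dens_word_le_one Q hQ)
  have hcard : ((Fintype.card (Fin m ⊕ Fin m) : ℕ) : ℝ≥0∞) = ENNReal.ofReal (2 * m) := by
    rw [Fintype.card_sum, Fintype.card_fin, ← two_mul, ← ENNReal.ofReal_natCast]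
    push_cast
    rfl
  have hm : (0 : ℝ) ≤ 2 * m := by positivity
  obtain ⟨C, hC⟩ := exists_scheme_of_codebook (α := α) (B := B) Q
    (f := fun i => densUZ Q QU (c i).1)
    (fun i => (measurable_densUZ Q QU).of_uncurry_left)
    (h := fun l i j => densUSZ Q (QUS l) (word l c i j))
    (fun l i j => (measurable_densUSZ Q (QUS l)).of_uncurry_left)
    (r := fun l i j => metric Q QUS l (word l c i j))
    (fun l i j => (measurable_metric Q l).of_uncurry_left) hc key msg hmsg hfib
  refine ⟨C, fun l => ?_⟩
  obtain ⟨herr, hprob, hsec⟩ := hC l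
  refine ⟨?_, hprob, ?_⟩
  · have h := herr.trans (hsel (Sum.inl l))
    rw [hcard, Sum.elim_inl, ← ENNReal.ofReal_add (add_nonneg hT (hTl l)) (hε l),
      ← ENNReal.ofReal_mul hm, ENNReal.ofReal_le_ofReal_iff
      (mul_nonneg hm (add_nonneg (add_nonneg hT (hTl l)) (hε l)))] at h
    refine h.trans (le_of_eq ?_)
    ring
  · have h := hsec.trans (hsel (Sum.inr l))
    rwa [hcard, Sum.elim_inr, ← ENNReal.ofReal_mul hm] at h

end
end OneCommunicator

open OneCommunicator in
theorem theorem3 {m : ℕ}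
    {𝒵 : Type*} [MeasurableSpace 𝒵] [StandardBorelSpace 𝒵] [Nonempty 𝒵]
    {𝒳 : Fin m → Type*} [∀ l, MeasurableSpace (𝒳 l)] [∀ l, StandardBorelSpace (𝒳 l)]
    {𝒰 : Type*} [MeasurableSpace 𝒰] [StandardBorelSpace 𝒰]
    {𝒮 : Fin m → Type*} [∀ l, MeasurableSpace (𝒮 l)] [∀ l, StandardBorelSpace (𝒮 l)]
    [∀ l, Nonempty (𝒮 l)]
    (Q : Measure (𝒵 × (∀ l, 𝒳 l))) [IsProbabilityMeasure Q]
    (QU : Kernel 𝒵 𝒰) [IsMarkovKernel QU]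
    (QUS : ∀ l, Kernel 𝒵 (𝒰 × 𝒮 l)) [∀ l, IsMarkovKernel (QUS l)]
    (hQ : ∀ l, ∀ᵐ z ∂Q.fst, (QUS l z).fst = QU z)
    (I : Fin (m + 1) → ℕ) (hI : ∀ i, 0 < I i) (J : Fin m → ℕ) (hJ : ∀ l, 0 < J l) :
    ∃ C : OneCommunicator.KeyScheme 𝒵 𝒳 (Fin (I 0))
        (fun l => Fin ((∏ i ∈ Finset.Iic l, I i.succ) * J l)),
      ∀ l : Fin m,
        C.errorProb Q l ≤ 2 * m * (OneCommunicator.quantEps Q QUS I +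
          OneCommunicator.quantT Q QU I + OneCommunicator.quantTl Q QUS J l) ∧
        C.secrecyGap Q l ≤
          ⨅ δ : Set.Ioo (0 : ℝ) ((((∏ i, I i) * J l : ℕ) : ℝ) ^ (3 / 2 : ℝ) * Real.exp (-1)),
            4 * m * (2 * OneCommunicator.quantT Q QU I + OneCommunicator.quantTl Q QUS J l +
              2 * (δ : ℝ)) *
              Real.log ((((∏ i, I i) * J l : ℕ) : ℝ) ^ (3 / 2 : ℝ) / (δ : ℝ)) := by
  have hIne : ∀ i, Nonempty (Fin (I i)) := fun i => ⟨⟨0, hI i⟩⟩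
  have hJne : ∀ l, Nonempty (Fin (J l)) := fun l => ⟨⟨0, hJ l⟩⟩
  have hcard : Fintype.card (∀ i, Fin (I i)) = ∏ i, I i := by simp [Fintype.card_pi]
  have hTl : ∀ l, 0 ≤ quantTl Q QUS J l := fun l => coveringTerm_nonneg _ _ _
  have hT : 0 ≤ quantT Q QU I := coveringTerm_nonneg _ _ _
  obtain ⟨C, hC⟩ := exists_scheme Q QU QUS hQ (fun i : ∀ i, Fin (I i) => i 0)
    (fun l => message I l J) (fun l i i' j j' h => ((message_eq_iff I l J).1 h).2)
    (fun l k w => by rw [← card_index_eq I l J, ← card_fiber I l J k w])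
    (fun l i j => card_confusable_le I l J i j)
  refine ⟨C, fun l => ?_⟩
  obtain ⟨herr, hprob, hsec⟩ := hC l
  rw [hcard, Fintype.card_fin] at herr
  rw [hcard, Fintype.card_fin (J l)] at hsec
  have hm1 : (1 : ℝ) ≤ m := by exact_mod_cast l.pos
  refine ⟨herr.trans ?_, ?_⟩
  · refine mul_le_mul_of_nonneg_left ?_ (by positivity)
    exact add_le_add (add_le_add (decodingTerm_le_quantEps Q QUS I l) le_rfl) le_rfl
  · have hpos : 0 < I 0 * ((∏ i ∈ Finset.Iic l, I i.succ) * J l) :=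
      Nat.mul_pos (hI 0) (Nat.mul_pos (Finset.prod_pos fun i _ => hI _) (hJ l))
    have hgap := secrecyGap_le (C.lawKW Q l)
      (x := 2 * m * (quantT Q QU I + quantTl Q QUS J l))
      (mul_nonneg (by positivity) (add_nonneg hT (hTl l)))
      (by simpa only [Fintype.card_fin] using Nat.one_le_iff_ne_zero.2 hpos.ne') hsec
    have hgap' : C.secrecyGap Q l ≤ Real.log (Fintype.card (Fin (I 0))) :=
      sub_le_self _ (condEntropy_nonneg _)
    simp only [Fintype.card_fin] at hgap hgap'
    have hn : 0 < (∏ i, I i) * J l := Nat.mul_pos (Finset.prod_pos fun i _ => hI i) (hJ l)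
    have hn1 : (1 : ℝ) ≤ ((∏ i, I i) * J l : ℕ) := by exact_mod_cast hn
    -- `|K| |W_l|` falls short of `I * J l` by the number of hidden indices.
    have hle1 : I 0 * ((∏ i ∈ Finset.Iic l, I i.succ) * J l) ≤ (∏ i, I i) * J l := by
      have h1 := card_index_eq I l J
      rw [hcard] at h1
      simp only [Fintype.card_fin] at h1
      rw [← h1]
      exact Nat.le_mul_of_pos_left _ Fintype.card_pos
    have hle2 : I 0 ≤ I 0 * ((∏ i ∈ Finset.Iic l, I i.succ) * J l) :=
      Nat.le_mul_of_pos_right _ (Nat.mul_pos (Finset.prod_pos fun i _ => hI _) (hJ l))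
    have hI0 : (0 : ℝ) < I 0 := by exact_mod_cast hI 0
    have hpos' : (0 : ℝ) < (I 0 * ((∏ i ∈ Finset.Iic l, I i.succ) * J l) : ℕ) := by
      exact_mod_cast hpos
    have : Nonempty (Set.Ioo (0 : ℝ)
        ((((∏ i, I i) * J l : ℕ) : ℝ) ^ (3 / 2 : ℝ) * Real.exp (-1))) :=
      (Set.nonempty_Ioo.2 (mul_pos (Real.rpow_pos_of_pos (by linarith) _)
        (Real.exp_pos _))).to_subtype
    refine le_ciInf fun δ => ?_
    -- The argument gives the excess with a single `T`; the stated `2 * T` and the slack in `δ` only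
    -- weaken it.
    refine gap_le_of_excess (a := quantT Q QU I + quantTl Q QUS J l)
      (L := Real.log (I 0 * ((∏ i ∈ Finset.Iic l, I i.succ) * J l) : ℕ)) m hm1 hn1 ?_ ?_ ?_ ?_ ?_
      ?_ δ.2.1 δ.2.2
    · linarith [hTl l]
    · linarith
    · exact Real.log_nonneg (by exact_mod_cast hpos)
    · exact Real.log_le_log hpos' (by exact_mod_cast hle1)
    · exact hgap'.trans (Real.log_le_log hI0 (by exact_mod_cast hle2))
    · simpa only [KeyScheme.secrecyGap, Fintype.card_fin] using hgap
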